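/- **Setting (nonautonomous systems).** Let $(X_n,d_n)_{n\ge0}$ be compact metric spaces, $f_n:X_n\to X_{n+1}$ an equicontinuous sequence of maps, $f_0^n=f_{n-1}\circ\cdots\circ f_0$, $f_0^0=\mathrm{id}$. * *Topological entropy.* $h_{\mathrm{top}}(f_\infty)=\sup_{\mathcal U_\infty}\limsup_{n\to\infty}\frac1n\log N\big(\bigvee_{i=0}^{n-1}(f_0^{i})^{-1}\mathcal U_i\big)$, the supremum over all sequences $\mathcal U_\infty=(\mathcal U_n)$ of open covers $\mathcal U_n$ of $X_n$ whose Lebesgue numbers are bounded away from $0$; $N(\cdot)$ is the minimal cardinality of a subcover. * *Metric entropy.* Let $\mu_\infty=(\mu_n)$ be Borel probability measures on $X_n$ with $(f_n)_*\mu_n=\mu_{n+1}$ (an invariant measure sequence, IMS). A sequence of finite Borel partitions $\mathcal P_n=\{P_{n,1},\dots,P_{n,k_n}\}$ of $X_n$ is *admissible* if $(k_n)$ is bounded and for every $\varepsilon>0$ there are $\delta>0$ and compact sets $K_{n,i}\subset P_{n,i}$ such that for all $n$: $\mu_n(P_{n,i}\setminus K_{n,i})\le\varepsilon$ for all $i$,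 and $d_n(x,y)\ge\delta$ for all $x\in K_{n,i}$, $y\in K_{n,j}$, $i<j$. Then $h(f_\infty,\mu_\infty)=\sup\limsup_{n\to\infty}\frac1nH_{\mu_0}\big(\bigvee_{i=0}^{n-1}(f_0^{i})^{-1}\mathcal P_i\big)$, the supremum over all admissible sequences, where $H_\mu(\mathcal P)=-\sum_{P\in\mathcal P}\mu(P)\log\mu(P)$. **Setting (NSFT).** Let $\mathcal A_i=\{1,\dots,l_i\}$ with $l_i\ge1$ and $\sup_il_i<\infty$, and let $L_i$ be $0$-$1$ matrices of size $l_i\times l_{i+1}$, none of whose rows or columns is zero. Put $L^{(k,n)}=L_kL_{k+1}\cdots L_{n-1}$ for $n>k$ and $L^{(k,k)}=I$. Let $w(n,m)$ be the number of words $(x_n,\dots,x_m)$ with $x_i\in\mathcal A_i$ and $(L_i)_{x_ix_{i+1}}=1$ for $n\le i<m$. Let $\Sigma^k$ be the set of sequences $(x_k,x_{k+1},\dots)$ with $x_i\in\mathcal A_i$ and $(L_i)_{x_ix_{i+1}}=1$ for all $i\ge k$, with the metric $d_k(x,y)=0$ if $x=y$, $d_k(x,y)=1$ if $x_k\ne y_k$,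 and $d_k(x,y)=w(k,r)^{-1}$ otherwise, where $r\ge k$ is the largest index such that $x_i=y_i$ for $k\le i\le r$. The maps are the left shifts $\sigma_k:\Sigma^k\to\Sigma^{k+1}$, $(x_k,x_{k+1},\dots)\mapsto(x_{k+1},x_{k+2},\dots)$. The system $(\Sigma^\infty,\sigma_\infty)$ is the NSFT. Assume that it is *primitive*: for every $i$ there is $n>i$ such that all entries of $L^{(i,n)}$ are positive. Let $N_k$ be the smallest $n\ge1$ such that all entries of $L^{(k,k+n)}$ are positive; the sequence $(L_i)$ is *uniformly primitive* if $(N_k)$ is bounded. **Parry IMS.** Let $\hat w_i$ be strictly positive column vectors and $\hat v_i^t$ strictly positive row vectors with $\hat w_i=L_i\hat w_{i+1}$ and $\hat v_i^tL_i=\hat v_{i+1}^t$ for all $i\ge0$. With $\|u\|=\sum_\alpha|u_\alpha|$ put $w_i=\hat w_i/\|\hat w_i\|$, $v_i^t=\hat v_i^t/(\hat v_i^tw_i)$, $\lambda_i=\|\hat w_i\|/\|\hat w_{i+1}\|$, $\lambda^{(k,m)}=\prod_{i=k}^{m-1}\lambda_i$ (so $\lambda^{(k,k)}=1$), $(\pi_i)_\alpha=(v_i)_\alpha(w_i)_\alpha$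 and $P_i=\lambda_i^{-1}W_i^{-1}L_iW_{i+1}$ with $W_i=\operatorname{diag}(w_i)$. The associated Parry IMS $\mu_\infty$ consists of the Borel probability measures $\mu_k$ on $\Sigma^k$ with $$\mu_k(\{y\in\Sigma^k:\ y_i=x_i,\ k\le i\le m\})=(\pi_k)_{x_k}(P_k)_{x_kx_{k+1}}\cdots(P_{m-1})_{x_{m-1}x_m}$$ for all $m\ge k$ and all $x_i\in\mathcal A_i$, $k\le i\le m$. **Theorem.** Let $\mu_\infty$ be a Parry IMS of a primitive NSFT $(\Sigma^\infty,\sigma_\infty)$, let $\lambda^{(k,m)}$ be defined by the sequence $(\hat w_i)$ used in its construction, and write $\|A\|=\sum_{\alpha,\beta}|A_{\alpha\beta}|$. Limits superior are taken in $[-\infty,\infty]$. (i) $$\limsup_{k\to\infty}\frac1k\log\lambda^{(0,k)}\ \le\ h(\sigma_\infty,\mu_\infty)\ \le\ \limsup_{k\to\infty}\frac1k\log\|L^{(0,k)}\|.$$ (ii) Both inequalities in (i) are equalities, and $h(\sigma_\infty,\mu_\infty)=h_{\mathrm{top}}(\sigma_\infty)$, provided that there are $\varepsilon>0$ and $k_0\in\mathbb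 N$ such that for all $k\ge k_0$, all $m\ge0$ with $w(k,k+m)>1/\varepsilon$, and every $\gamma\in\mathcal A_k$ with $\sum_\alpha L^{(0,k)}_{\alpha\gamma}=\max_{\beta\in\mathcal A_k}\sum_\alpha L^{(0,k)}_{\alpha\beta}$, one has $L^{(k,k+m)}_{\gamma\beta}\ge1$ for all $\beta\in\mathcal A_{k+m}$. (iii) Both inequalities in (i) are equalities, and $h(\sigma_\infty,\mu_\infty)=h_{\mathrm{top}}(\sigma_\infty)$, also if $$\limsup_{k\to\infty}\frac1k\log\lambda^{(k,k+N_k)}=0.$$ This last condition holds in particular whenever $(L_i)$ is uniformly primitive. -/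

import Mathlib

/-! ### Nonautonomous dynamical systems: topological and metric entropy -/

namespace NDS

open MeasureTheory Filter

section

universe u

variable {X : ℕ → Type u}

/-- The composition `f_0^n = f_{n-1} ∘ ⋯ ∘ f_0 : X_0 → X_n` along a nonautonomous system. -/
def iter (f : ∀ n, X n → X (n + 1)) : ∀ n, X 0 → X n
  | 0 => id
  | n + 1 => f n ∘ iter f n

/-- The minimal number of members of `C` needed to cover the space (`⊤` if there is no finite
subcover). -/
noncomputable def coverNumber {Y : Type u} (C : Set (Set Y)) : ℕ∞ :=
  ⨅ (D : Set (Set Y)) (_ : D ⊆ C ∧ ⋃₀ D = Set.univ), D.encard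

/-- The join `⋁_{i=0}^{n-1} f_0^{-i} U_i` of the pulled back families `U_i`. -/
def coverJoin (f : ∀ n, X n → X (n + 1)) (U : ∀ n, Set (Set (X n))) (n : ℕ) : Set (Set (X 0)) :=
  {V | ∃ A : ∀ i, Set (X i), (∀ i < n, A i ∈ U i) ∧ V = ⋂ i ∈ Set.Iio n, iter f i ⁻¹' A i}

/-- `U` is a sequence of open covers whose Lebesgue numbers are bounded away from zero. -/
def IsLebesgueCoverSeq [∀ n, MetricSpace (X n)] (U : ∀ n, Set (Set (X n))) : Prop :=
  (∀ n, (∀ A ∈ U n, IsOpen A) ∧ ⋃₀ U n = Set.univ) ∧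
    ∃ δ > (0 : ℝ), ∀ n, ∀ x : X n, ∃ A ∈ U n, Metric.ball x δ ⊆ A

/-- `limsup_n (1/n) log N(⋁_{i=0}^{n-1} f_0^{-i} U_i)`. -/
noncomputable def topEntropyOn (f : ∀ n, X n → X (n + 1)) (U : ∀ n, Set (Set (X n))) : EReal :=
  limsup (fun n : ℕ => ENNReal.log (coverNumber (coverJoin f U n) : ENNReal) / (n : EReal)) atTop

/-- The topological entropy of a nonautonomous system: the supremum over all sequences of open
covers with Lebesgue numbers bounded away from zero. -/
noncomputable def topEntropy [∀ n, MetricSpace (X n)] (f : ∀ n, X n → X (n + 1)) : EReal :=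
  ⨆ (U : ∀ n, Set (Set (X n))) (_ : IsLebesgueCoverSeq U), topEntropyOn f U

/-- A sequence of finite measurable partitions `{P_{n,1}, …, P_{n,k_n}}` of the spaces `X_n`. -/
structure PartitionSeq (X : ℕ → Type u) [∀ n, MeasurableSpace (X n)] where
  /-- the number `k_n` of cells -/
  card : ℕ → ℕ
  /-- the cells `P_{n,i}` -/
  cell : ∀ n, Fin (card n) → Set (X n)
  measurable_cell : ∀ n i, MeasurableSet (cell n i)
  disjoint_cell : ∀ n i j, i ≠ j → Disjoint (cell n i) (cell n j)
  iUnion_cell : ∀ n, ⋃ i, cell n i = Set.univ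

/-- Admissible sequences of partitions: the class `E_Mis(μ_∞)`. -/
def PartitionSeq.IsAdmissible [∀ n, MetricSpace (X n)] [∀ n, MeasurableSpace (X n)]
    (P : PartitionSeq X) (μ : ∀ n, Measure (X n)) : Prop :=
  (∃ C : ℕ, ∀ n, P.card n ≤ C) ∧
    ∀ ε > (0 : ℝ), ∃ δ > (0 : ℝ), ∃ K : ∀ n, Fin (P.card n) → Set (X n), ∀ n,
      (∀ i, IsCompact (K n i) ∧ K n i ⊆ P.cell n i) ∧
      (∀ i, μ n (P.cell n i \ K n i) ≤ ENNReal.ofReal ε) ∧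
      ∀ i j, i < j → ∀ x ∈ K n i, ∀ y ∈ K n j, δ ≤ dist x y

/-- The Shannon entropy `- ∑ μ(P) log μ(P)` of a finite family of sets. -/
noncomputable def shannonEntropy {Y : Type u} [MeasurableSpace Y] {ι : Type} [Fintype ι]
    (μ : Measure Y) (A : ι → Set Y) : ℝ :=
  ∑ i, Real.negMulLog (μ.real (A i))

/-- The cells of the join `⋁_{i=0}^{n-1} f_0^{-i} P_i`, indexed by the itineraries `a`. -/
def PartitionSeq.joinCell [∀ n, MeasurableSpace (X n)] (P : PartitionSeq X)
    (f : ∀ n, X n → X (n + 1)) (n : ℕ) (a : ∀ i : Fin n, Fin (P.card i)) : Set (X 0) :=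
  ⋂ i : Fin n, iter f i ⁻¹' P.cell i (a i)

/-- `limsup_n (1/n) H_{μ_0}(⋁_{i=0}^{n-1} f_0^{-i} P_i)`. -/
noncomputable def metricEntropyOn [∀ n, MeasurableSpace (X n)] (f : ∀ n, X n → X (n + 1))
    (μ : ∀ n, Measure (X n)) (P : PartitionSeq X) : EReal :=
  limsup (fun n : ℕ => ((shannonEntropy (μ 0) (P.joinCell f n) / n : ℝ) : EReal)) atTop

/-- The metric entropy of a nonautonomous system with respect to a sequence of measures: the
supremum over all admissible sequences of partitions. -/
noncomputable def metricEntropy [∀ n, MetricSpace (X n)] [∀ n, MeasurableSpace (X n)]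
    (f : ∀ n, X n → X (n + 1)) (μ : ∀ n, Measure (X n)) : EReal :=
  ⨆ (P : PartitionSeq X) (_ : P.IsAdmissible μ), metricEntropyOn f μ P

end

end NDS

/-! ### Nonstationary subshifts of finite type -/

/-- The data of a nonstationary subshift of finite type: nonempty alphabets `{1, …, l_i}` of
bounded size, and a reduced sequence of `0`-`1` transition matrices `L_i`. -/
structure NSFT where
  /-- the alphabet sizes -/
  l : ℕ → ℕ
  /-- the transition matrices -/
  L : ∀ i, Matrix (Fin (l i)) (Fin (l (i + 1))) ℝ
  l_pos : ∀ i, 0 < l i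
  entries : ∀ i α β, L i α β = 0 ∨ L i α β = 1
  row_ne_zero : ∀ i α, ∃ β, L i α β ≠ 0
  col_ne_zero : ∀ i β, ∃ α, L i α β ≠ 0
  l_bdd : ∃ B, ∀ i, l i ≤ B

namespace NSFT

open MeasureTheory Filter

variable (S : NSFT)

/-- Admissible words `(x_n, …, x_m)`. -/
def Word (n m : ℕ) : Type :=
  {x : ∀ i : Set.Icc n m, Fin (S.l i) //
    ∀ (i : ℕ) (h₁ : n ≤ i) (h₂ : i + 1 ≤ m),
      S.L i (x ⟨i, h₁, by omega⟩) (x ⟨i + 1, by omega, h₂⟩) = 1}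

/-- The number `w(n,m)` of admissible words `(x_n, …, x_m)`. -/
noncomputable def w (n m : ℕ) : ℕ := Nat.card (S.Word n m)

/-- The space of admissible sequences `(x_k, x_{k+1}, …)`, indexed by the integers `i ≥ k`. -/
def Seq (k : ℕ) : Type :=
  {x : ∀ i : Set.Ici k, Fin (S.l i) //
    ∀ (i : ℕ) (h : k ≤ i), S.L i (x ⟨i, h⟩) (x ⟨i + 1, Nat.le_succ_of_le h⟩) = 1}

variable {S} in
/-- The letter `x_i` of a sequence `x = (x_k, x_{k+1}, …)`, `i ≥ k`. -/
def Seq.letter {k : ℕ} (x : S.Seq k) (i : ℕ) (h : k ≤ i) : Fin (S.l i) := x.1 ⟨i, h⟩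

/-- The left shift `(x_k, x_{k+1}, x_{k+2}, …) ↦ (x_{k+1}, x_{k+2}, …)`; in our indexing the
letter with index `i ≥ k + 1` is unchanged. -/
def shift (k : ℕ) (x : S.Seq k) : S.Seq (k + 1) :=
  ⟨fun i => x.letter i (Nat.le_of_succ_le i.2), fun i h => x.2 i (Nat.le_of_succ_le h)⟩

section Metric

variable {S}

/-- The least index at which two sequences differ. If it is `r + 1 > k`, then `r` is the largest
index such that the sequences agree on `k, …, r`. -/
noncomputable def firstDiff {k : ℕ} (x y : S.Seq k) : ℕ :=
  sInf {i | ∃ h : k ≤ i, x.letter i h ≠ y.letter i h}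

open Classical in
/-- The metric `d_k`: it is `0` if `x = y`, `1` if `x_k ≠ y_k`, and otherwise `w(k,r)⁻¹`, where
`r` is the largest index such that `x` and `y` agree on `k, …, r`. -/
noncomputable def seqDist {k : ℕ} (x y : S.Seq k) : ℝ :=
  if x = y then 0
  else if x.letter k le_rfl ≠ y.letter k le_rfl then 1
  else ((S.w k (firstDiff x y - 1) : ℕ) : ℝ)⁻¹

theorem seq_ext {k : ℕ} {x y : S.Seq k} (h : ∀ i hi, x.letter i hi = y.letter i hi) : x = y :=
  Subtype.ext (funext fun i => h i.1 i.2)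

theorem firstDiff_mem {k : ℕ} {x y : S.Seq k} (h : x ≠ y) :
    ∃ hi : k ≤ firstDiff x y, x.letter _ hi ≠ y.letter _ hi := by
  have hne : {i | ∃ h : k ≤ i, x.letter i h ≠ y.letter i h}.Nonempty := by
    by_contra hcon
    apply h
    apply seq_ext
    intro i hi
    by_contra hh
    exact hcon ⟨i, hi, hh⟩
  exact Nat.sInf_mem hne

theorem firstDiff_le {k : ℕ} {x y : S.Seq k} {i : ℕ} (hi : k ≤ i)
    (h : x.letter i hi ≠ y.letter i hi) : firstDiff x y ≤ i :=
  Nat.sInf_le ⟨hi, h⟩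

theorem firstDiff_comm {k : ℕ} (x y : S.Seq k) : firstDiff x y = firstDiff y x := by
  unfold firstDiff
  simp only [ne_comm]

instance (n m : ℕ) : Finite (S.Word n m) := by
  unfold Word
  infer_instance

theorem w_le_succ {n m : ℕ} (h : n ≤ m) : S.w n m ≤ S.w n (m + 1) := by
  classical
  refine Nat.card_le_card_of_surjective
    (fun x : S.Word n (m + 1) => (⟨fun i => x.1 ⟨i.1, i.2.1, Nat.le_succ_of_le i.2.2⟩,
      fun i h₁ h₂ => x.2 i h₁ (Nat.le_succ_of_le h₂)⟩ : S.Word n m)) ?_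
  intro x
  obtain ⟨β, hβ⟩ := S.row_ne_zero m (x.1 ⟨m, h, le_rfl⟩)
  have hβ1 := (S.entries _ _ _).resolve_left hβ
  let z : ∀ i, Fin (S.l i) := Function.update (fun i => ⟨0, S.l_pos i⟩) (m + 1) β
  refine ⟨⟨fun i => if hi : i.1 ≤ m then x.1 ⟨i.1, i.2.1, hi⟩ else z i.1, ?_⟩, ?_⟩
  · intro i h₁ h₂
    by_cases him : i + 1 ≤ m
    · have := x.2 i h₁ him
      have hi : i ≤ m := by omega
      simpa [hi, him] using this
    · obtain rfl : i = m := by omega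
      simpa [z] using hβ1
  · apply Subtype.ext
    funext i
    simp [i.2.2]

theorem w_mono {k r s : ℕ} (h : k ≤ r) (hrs : r ≤ s) : S.w k r ≤ S.w k s := by
  induction s, hrs using Nat.le_induction with
  | base => exact le_rfl
  | succ s hs ih => exact ih.trans (w_le_succ (h.trans hs))

theorem w_pos {k r : ℕ} (h : k ≤ r) : 0 < S.w k r := by
  refine lt_of_lt_of_le ?_ (w_mono le_rfl h)
  have : Nonempty (S.Word k k) := ⟨⟨fun i => ⟨0, S.l_pos i⟩, fun i h₁ h₂ => by omega⟩⟩
  exact Nat.card_pos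

theorem seqDist_le_one {k : ℕ} (x y : S.Seq k) : seqDist x y ≤ 1 := by
  unfold seqDist
  split_ifs with h1 h2
  · exact zero_le_one
  · exact le_rfl
  · push Not at h2
    obtain ⟨hi, hd⟩ := firstDiff_mem h1
    have hne : firstDiff x y ≠ k := by
      intro h
      apply hd
      have key : ∀ j (hj : k ≤ j), j = k → x.letter j hj = y.letter j hj := by
        rintro j hj rfl
        exact h2
      exact key _ _ h
    have : 0 < S.w k (firstDiff x y - 1) := w_pos (by omega)
    exact inv_le_one_of_one_le₀ (by exact_mod_cast this)

theorem seqDist_pos {k : ℕ} {x y : S.Seq k} (h : x ≠ y) : 0 < seqDist x y := by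
  unfold seqDist
  rw [if_neg h]
  split_ifs with h2
  · exact zero_lt_one
  · push Not at h2
    obtain ⟨hi, hd⟩ := firstDiff_mem h
    have hne : firstDiff x y ≠ k := by
      intro h
      apply hd
      have key : ∀ j (hj : k ≤ j), j = k → x.letter j hj = y.letter j hj := by
        rintro j hj rfl
        exact h2
      exact key _ _ h
    have : 0 < S.w k (firstDiff x y - 1) := w_pos (by omega)
    positivity

theorem seqDist_comm {k : ℕ} (x y : S.Seq k) : seqDist x y = seqDist y x := by
  unfold seqDist
  rw [firstDiff_comm x y, eq_comm (a := x)]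
  simp only [ne_comm (a := x.letter k le_rfl)]

theorem seqDist_le_of_firstDiff_le {k : ℕ} {x y z u : S.Seq k} (h : z ≠ u)
    (hle : firstDiff z u ≤ firstDiff x y) : seqDist x y ≤ seqDist z u := by
  by_cases hz : z.letter k le_rfl = u.letter k le_rfl
  · obtain ⟨hi, hd⟩ := firstDiff_mem h
    have hne : firstDiff z u ≠ k := by
      intro h
      apply hd
      have key : ∀ j (hj : k ≤ j), j = k → z.letter j hj = u.letter j hj := by
        rintro j hj rfl
        exact hz
      exact key _ _ h
    by_cases hxy : x = y
    · simpa [seqDist, hxy] using (seqDist_pos h).le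
    have hx : x.letter k le_rfl = y.letter k le_rfl := by
      by_contra hcon
      have := firstDiff_le le_rfl hcon
      omega
    have hp : 0 < S.w k (firstDiff z u - 1) := w_pos (by omega)
    have hm : S.w k (firstDiff z u - 1) ≤ S.w k (firstDiff x y - 1) :=
      w_mono (by omega) (by omega)
    simp only [seqDist, hxy, h, hx, hz, if_false, ne_eq, not_true_eq_false]
    gcongr
  · have : seqDist z u = 1 := by simp [seqDist, h, hz]
    rw [this]
    exact seqDist_le_one x y

theorem seqDist_triangle {k : ℕ} (x y z : S.Seq k) :
    seqDist x z ≤ seqDist x y + seqDist y z := by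
  have h0 : ∀ a b : S.Seq k, 0 ≤ seqDist a b := by
    intro a b
    by_cases h : a = b
    · simp [seqDist, h]
    · exact (seqDist_pos h).le
  by_cases hxy : x = y
  · subst hxy; linarith [h0 x x]
  by_cases hyz : y = z
  · subst hyz; linarith [h0 y y]
  by_cases hxz : x = z
  · subst hxz; linarith [h0 x y, h0 y x, show seqDist x x = 0 by simp [seqDist]]
  obtain ⟨hi, hd⟩ := firstDiff_mem hxz
  by_cases h : x.letter _ hi = y.letter _ hi
  · have h' : y.letter _ hi ≠ z.letter _ hi := fun e => hd (h.trans e)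
    linarith [seqDist_le_of_firstDiff_le hyz (firstDiff_le hi h'), h0 x y]
  · linarith [seqDist_le_of_firstDiff_le hxy (firstDiff_le hi h), h0 y z]

noncomputable instance (k : ℕ) : MetricSpace (S.Seq k) where
  dist := seqDist
  dist_self x := by simp [seqDist]
  dist_comm := seqDist_comm
  dist_triangle := seqDist_triangle
  eq_of_dist_eq_zero {x y} h := by
    by_contra hne
    exact (seqDist_pos hne).ne' h

noncomputable instance (k : ℕ) : MeasurableSpace (S.Seq k) := borel _

instance (k : ℕ) : BorelSpace (S.Seq k) := ⟨rfl⟩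

end Metric

/-- The product `L^{(k,n)} = L_k L_{k+1} ⋯ L_{n-1}`, with `L^{(k,k)}` the identity matrix. -/
noncomputable def matProd {k n : ℕ} (h : k ≤ n) : Matrix (Fin (S.l k)) (Fin (S.l n)) ℝ :=
  Nat.leRec (motive := fun n _ => Matrix (Fin (S.l k)) (Fin (S.l n)) ℝ) 1
    (fun n _ M => M * S.L n) h

/-- The sum norm `∑_{α,β} |A_{αβ}|` of a matrix. -/
def sumNorm {a b : ℕ} (A : Matrix (Fin a) (Fin b) ℝ) : ℝ := ∑ α, ∑ β, |A α β|

/-- The sequence of matrices is primitive. -/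
def IsPrimitive : Prop :=
  ∀ i, ∃ (n : ℕ) (h : i < n), ∀ α β, 0 < S.matProd h.le α β

/-- `N_k`: the smallest `n ≥ 1` such that all entries of `L^{(k,k+n)}` are positive. -/
noncomputable def primIndex (k : ℕ) : ℕ :=
  sInf {n | 1 ≤ n ∧ ∀ α β, 0 < S.matProd (Nat.le_add_right k n) α β}

/-- The sequence of matrices is uniformly primitive: primitive with bounded `N_k`. -/
def IsUniformlyPrimitive : Prop :=
  S.IsPrimitive ∧ ∃ B, ∀ k, S.primIndex k ≤ B

/-- Strictly positive column vectors with `ŵ_i = L_i ŵ_{i+1}`. -/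
def IsColSeq (w' : ∀ i, Fin (S.l i) → ℝ) : Prop :=
  ∀ i, (∀ α, 0 < w' i α) ∧ w' i = (S.L i).mulVec (w' (i + 1))

/-- Strictly positive row vectors with `v̂_i L_i = v̂_{i+1}`. -/
def IsRowSeq (v' : ∀ i, Fin (S.l i) → ℝ) : Prop :=
  ∀ i, (∀ α, 0 < v' i α) ∧ Matrix.vecMul (v' i) (S.L i) = v' (i + 1)

/-- The `ℓ¹` norm of a vector. -/
def vecNorm {a : ℕ} (u : Fin a → ℝ) : ℝ := ∑ α, |u α|

variable {S} in
/-- The normalized column vectors `w_i = ŵ_i / ‖ŵ_i‖`. -/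
noncomputable def colVec (w' : ∀ i, Fin (S.l i) → ℝ) (i : ℕ) : Fin (S.l i) → ℝ :=
  (vecNorm (w' i))⁻¹ • w' i

variable {S} in
/-- The normalized row vectors `v_i = v̂_i / (v̂_i w_i)`. -/
noncomputable def rowVec (w' v' : ∀ i, Fin (S.l i) → ℝ) (i : ℕ) : Fin (S.l i) → ℝ :=
  (v' i ⬝ᵥ colVec w' i)⁻¹ • v' i

variable {S} in
/-- The eigenvalues `λ_i = ‖ŵ_i‖ / ‖ŵ_{i+1}‖`. -/
noncomputable def eigen (w' : ∀ i, Fin (S.l i) → ℝ) (i : ℕ) : ℝ :=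
  vecNorm (w' i) / vecNorm (w' (i + 1))

variable {S} in
/-- `λ^{(k,m)} = λ_k ⋯ λ_{m-1}`, which is `1` for `k = m`. -/
noncomputable def eigenProd (w' : ∀ i, Fin (S.l i) → ℝ) (k m : ℕ) : ℝ :=
  ∏ i ∈ Finset.Ico k m, eigen w' i

variable {S} in
/-- The probability vectors `π_i`, `(π_i)_α = (v_i)_α (w_i)_α`. -/
noncomputable def parryVec (w' v' : ∀ i, Fin (S.l i) → ℝ) (i : ℕ) (α : Fin (S.l i)) : ℝ :=
  rowVec w' v' i α * colVec w' i α

/-- The stochastic matrices `P_i = (1/λ_i) W_i⁻¹ L_i W_{i+1}`, where `W_i` is the diagonal matrix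
with the entries of `w_i` on the diagonal. -/
noncomputable def parryMat (w' : ∀ i, Fin (S.l i) → ℝ) (i : ℕ) :
    Matrix (Fin (S.l i)) (Fin (S.l (i + 1))) ℝ :=
  (eigen w' i)⁻¹ • (Matrix.diagonal (fun α => (colVec w' i α)⁻¹) * S.L i *
    Matrix.diagonal (colVec w' (i + 1)))

variable {S} in
/-- The cylinder `[.x_k … x_m]`; only the letters `x_k, …, x_m` of `x` matter. -/
def cylinder (k m : ℕ) (x : ∀ i, Fin (S.l i)) : Set (S.Seq k) :=
  {y | ∀ (i : ℕ) (h : k ≤ i), i ≤ m → y.letter i h = x i}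

/-- `μ` is the Parry invariant measure sequence built from the eigenvector sequences `w'`, `v'`:
the sequence of probability measures whose values on cylinders are
`μ_k([.x_k … x_m]) = (π_k)_{x_k} (P_k)_{x_k x_{k+1}} ⋯ (P_{m-1})_{x_{m-1} x_m}`. -/
structure IsParryIMS (w' v' : ∀ i, Fin (S.l i) → ℝ) (μ : ∀ k, Measure (S.Seq k)) : Prop where
  colSeq : S.IsColSeq w'
  rowSeq : S.IsRowSeq v'
  isProb : ∀ k, IsProbabilityMeasure (μ k)
  cylinder_eq : ∀ k m, k ≤ m → ∀ x : ∀ i, Fin (S.l i),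
    μ k (cylinder k m x) = ENNReal.ofReal
      (parryVec w' v' k (x k) * ∏ i ∈ Finset.Ico k m, S.parryMat w' i (x i) (x (i + 1)))

/-- `limsup_k (1/k) log λ^{(0,k)}`. -/
noncomputable def eigenGrowth (w' : ∀ i, Fin (S.l i) → ℝ) : EReal :=
  limsup (fun k : ℕ => ((Real.log (eigenProd w' 0 k) / k : ℝ) : EReal)) atTop

/-- `limsup_k (1/k) log ‖L^{(0,k)}‖` with the sum norm. -/
noncomputable def matGrowth : EReal :=
  limsup (fun k : ℕ => ((Real.log (sumNorm (S.matProd (Nat.zero_le k))) / k : ℝ) : EReal)) atTop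

/-- `limsup_k (1/k) log λ^{(k,k+N_k)}`. -/
noncomputable def eigenPrimGrowth (w' : ∀ i, Fin (S.l i) → ℝ) : EReal :=
  limsup (fun k : ℕ => ((Real.log (eigenProd w' k (k + S.primIndex k)) / k : ℝ) : EReal)) atTop

/-- The letter `γ` maximizes the column sums of `L^{(0,k)}`. -/
def IsMaxCol (k : ℕ) (γ : Fin (S.l k)) : Prop :=
  ∀ β, ∑ α, S.matProd (Nat.zero_le k) α β ≤ ∑ α, S.matProd (Nat.zero_le k) α γ

/-- Best receivers are broadcasters: there are `ε > 0` and `k₀` such that for all `k ≥ k₀` and all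
`m` with `w(k,k+m) > 1/ε`, every `γ` maximizing the column sums of `L^{(0,k)}` satisfies
`L^{(k,k+m)}_{γβ} ≥ 1` for all `β`. -/
def BestReceiversBroadcast : Prop :=
  ∃ ε > (0 : ℝ), ∃ k₀ : ℕ, ∀ k ≥ k₀, ∀ m : ℕ, 1 / ε < (S.w k (k + m) : ℝ) →
    ∀ γ, S.IsMaxCol k γ → ∀ β, 1 ≤ S.matProd (Nat.le_add_right k m) γ β

end NSFT

/-! Everything is compared with the word count w(0,n), which equals ‖L^{(0,n)}‖ because matrix
products count paths (`sum_word_last`).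

The metric is built so that cylinders of diameter below δ at any time k need only boundedly many
words, uniformly in k (`exists_uniform_small_cylinders`). Hence recording all points at times i < n
up to precision δ costs one word (x_0, …, x_R) with w(0,R) ≤ C·w(0,n). This gives the upper bound
for topological entropy; the cover by letters gives the reverse bound. For metric entropy, an
admissible partition is predicted by small cylinders up to an error of small entropy per time step
(`IsParryIMS.shannonEntropy_joinCell_le`).

For the lower bound, the Parry measure of a cylinder telescopes to at most a constant times ‖ŵ_m‖ =
‖ŵ_0‖/λ^{(0,m)} (`parry_cylinder_le`), so the letter partition already has entropy at least log
λ^{(0,m)} up to a constant.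

Equality needs only that ‖L^{(0,k)}‖ does not outgrow λ^{(0,k)}. If a letter γ of maximal column sum
s is connected to all letters at time n, then ŵ_k(γ) ≥ ‖ŵ_n‖, so ‖ŵ_0‖ ≥ s‖ŵ_n‖ and ‖L^{(0,k)}‖ ≤
B·λ^{(0,k)}·λ^{(k,n)} (`w_le_eigenProd_mul`). The factor λ^{(k,n)} is bounded under (ii) and
subexponential under (iii). -/

open Filter Topology in
/-- If `a n ≤ b n + o(n)`, then `limsup a n / n ≤ limsup b n / n`. -/
theorem limsup_div_le_limsup_div {a b : ℕ → ℝ}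
    (h : ∀ η > (0 : ℝ), ∃ C : ℝ, ∀ᶠ n : ℕ in atTop, a n ≤ b n + C + η * n) :
    limsup (fun n : ℕ => ((a n / n : ℝ) : EReal)) atTop ≤
      limsup (fun n : ℕ => ((b n / n : ℝ) : EReal)) atTop := by
  refine le_of_forall_gt_imp_ge_of_dense fun c hc => ?_
  obtain ⟨s, hs, hsc⟩ := EReal.lt_iff_exists_real_btwn.1 hc
  obtain ⟨r, hr, hrs⟩ := EReal.lt_iff_exists_real_btwn.1 hs
  have hrs' : r < s := by exact_mod_cast hrs
  -- The gap s - r is spent in halves: one for η, the other for C/n.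
  obtain ⟨C, hC⟩ := h ((s - r) / 2) (by linarith)
  refine le_trans ?_ hsc.le
  refine limsup_le_of_le (by isBoundedDefault) ?_
  have hlim : Tendsto (fun n : ℕ => C / (n : ℝ)) atTop (𝓝 0) :=
    tendsto_const_div_atTop_nhds_zero_nat C
  filter_upwards [hC, eventually_lt_of_limsup_lt hr,
    hlim.eventually (gt_mem_nhds (show (0 : ℝ) < (s - r) / 2 by linarith)),
    eventually_gt_atTop 0] with n h1 h2 h3 h4
  have h2' : b n / n < r := by exact_mod_cast h2
  have hn : (0 : ℝ) < n := by exact_mod_cast h4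
  have : a n / n ≤ s := by
    rw [div_le_iff₀ hn]
    rw [div_lt_iff₀ hn] at h2' h3
    nlinarith
  exact_mod_cast this

/-! ### Words, cylinders and the size of balls. -/

namespace NSFT

open Filter

variable {S : NSFT}

theorem exists_L_eq_one (i : ℕ) (α : Fin (S.l i)) : ∃ β, S.L i α β = 1 :=
  (S.row_ne_zero i α).imp fun _ h => (S.entries _ _ _).resolve_left h

theorem L_nonneg (i : ℕ) (α β) : 0 ≤ S.L i α β := by
  rcases S.entries i α β with h | h <;> simp [h]

/-- The letter `x_i` of a word `(x_k, …, x_m)`. -/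
def Word.letter {k m : ℕ} (x : S.Word k m) (i : ℕ) (h : i ∈ Set.Icc k m) : Fin (S.l i) :=
  x.1 ⟨i, h⟩

theorem Word.ext_letter {k m : ℕ} {x y : S.Word k m}
    (h : ∀ i hi, x.letter i hi = y.letter i hi) : x = y :=
  Subtype.ext (funext fun i => h i.1 i.2)

/-- A full sequence of letters extending a word, admissible from the beginning of the word on. -/
noncomputable def Word.extend {k m : ℕ} (x : S.Word k m) : ∀ i, Fin (S.l i)
  | 0 => if h : k ≤ 0 ∧ 0 ≤ m then x.1 ⟨0, h⟩ else ⟨0, S.l_pos 0⟩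
  | i + 1 => if h : k ≤ i + 1 ∧ i + 1 ≤ m then x.1 ⟨i + 1, h⟩ else
      (exists_L_eq_one i (Word.extend x i)).choose

theorem Word.extend_of_mem {k m : ℕ} (x : S.Word k m) {i : ℕ} (h : i ∈ Set.Icc k m) :
    x.extend i = x.letter i h := by
  cases i with
  | zero => rw [Word.extend, dif_pos (show k ≤ 0 ∧ 0 ≤ m from h)]; rfl
  | succ i => rw [Word.extend, dif_pos (show k ≤ i + 1 ∧ i + 1 ≤ m from h)]; rfl

theorem Word.extend_admissible {k m : ℕ} (x : S.Word k m) (i : ℕ) (h : k ≤ i) :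
    S.L i (x.extend i) (x.extend (i + 1)) = 1 := by
  by_cases h2 : i + 1 ≤ m
  · rw [x.extend_of_mem ⟨h, by omega⟩, x.extend_of_mem ⟨by omega, h2⟩]
    exact x.2 i h h2
  · rw [Word.extend.eq_2, dif_neg (by omega)]
    exact (exists_L_eq_one i _).choose_spec

/-- A sequence extending a word. -/
noncomputable def Word.toSeq {k m : ℕ} (x : S.Word k m) : S.Seq k :=
  ⟨fun i => x.extend i, fun i h => x.extend_admissible i h⟩

/-- The word `(x_k, …, x_m)` of a sequence. -/
def Seq.word {k : ℕ} (m : ℕ) (x : S.Seq k) : S.Word k m :=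
  ⟨fun i => x.letter i i.2.1, fun i h₁ _ => x.2 i h₁⟩

theorem Word.word_toSeq {k m : ℕ} (x : S.Word k m) : x.toSeq.word m = x :=
  Subtype.ext (funext fun i => x.extend_of_mem i.2)

theorem Seq.word_eq_iff {k m : ℕ} {x y : S.Seq k} :
    x.word m = y.word m ↔ ∀ i hi, i ≤ m → x.letter i hi = y.letter i hi := by
  constructor
  · intro h i hi him
    exact congrFun (congrArg Subtype.val h) ⟨i, hi, him⟩
  · intro h
    exact Subtype.ext (funext fun i => h i.1 i.2.1 i.2.2)

noncomputable instance (n m : ℕ) : Fintype (S.Word n m) := Fintype.ofFinite _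

/-- A letter sequence agreeing with `x` from `k` on. -/
def Seq.full {k : ℕ} (x : S.Seq k) (i : ℕ) : Fin (S.l i) :=
  if h : k ≤ i then x.letter i h else ⟨0, S.l_pos i⟩

theorem Seq.full_of_le {k : ℕ} (x : S.Seq k) {i : ℕ} (h : k ≤ i) : x.full i = x.letter i h :=
  dif_pos h

theorem w_self_le (k : ℕ) : S.w k k ≤ S.l k := by
  have : Function.Injective (fun x : S.Word k k => x.1 ⟨k, le_rfl, le_rfl⟩) := by
    intro x y h
    refine Subtype.ext (funext ?_)
    rintro ⟨i, hi1, hi2⟩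
    obtain rfl : i = k := le_antisymm hi2 hi1
    exact h
  simpa [w] using Nat.card_le_card_of_injective _ this

/-- The intervals [k,j] and [j',m] leave no gap, so a word is determined by its two pieces. The
index j may exceed m, which is why the first piece is read off from an extension of the word. -/
theorem w_le_mul (k j j' m : ℕ) (h₁ : k ≤ j') (h₂ : j' ≤ j + 1) :
    S.w k m ≤ S.w k j * S.w j' m := by
  rw [w, w, w, ← Nat.card_prod]
  refine Nat.card_le_card_of_injective (fun x : S.Word k m => (x.toSeq.word j,
    (⟨fun i => x.1 ⟨i.1, h₁.trans i.2.1, i.2.2⟩,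
      fun i h h' => x.2 i (h₁.trans h) h'⟩ : S.Word j' m))) ?_
  intro x y h
  refine Subtype.ext (funext ?_)
  rintro ⟨i, hi1, hi2⟩
  by_cases hij : i ≤ j
  · have := Seq.word_eq_iff.1 (congrArg Prod.fst h) i hi1 hij
    exact (x.extend_of_mem ⟨hi1, hi2⟩).symm.trans (this.trans (y.extend_of_mem ⟨hi1, hi2⟩))
  · exact congrFun (congrArg Subtype.val (congrArg Prod.snd h)) ⟨i, by omega, hi2⟩

theorem w_succ_le {B : ℕ} (hB : ∀ i, S.l i ≤ B) {k m : ℕ} (h : k ≤ m) :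
    S.w k (m + 1) ≤ S.w k m * B :=
  (w_le_mul k m (m + 1) (m + 1) (by omega) le_rfl).trans
    (Nat.mul_le_mul_left _ ((w_self_le _).trans (hB _)))

theorem dist_le_of_agree {k r : ℕ} (h : k ≤ r) {x y : S.Seq k} (hxy : x.word r = y.word r) :
    dist x y ≤ (S.w k r : ℝ)⁻¹ := by
  change seqDist x y ≤ _
  rw [Seq.word_eq_iff] at hxy
  by_cases he : x = y
  · simp [seqDist, he]
  obtain ⟨hi, hd⟩ := firstDiff_mem he
  have hr : r < firstDiff x y := by
    by_contra hcon
    exact hd (hxy _ hi (by omega))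
  rw [seqDist, if_neg he, if_neg (by simpa using hxy k le_rfl h)]
  have h1 : 0 < S.w k r := w_pos h
  have h2 : S.w k r ≤ S.w k (firstDiff x y - 1) := w_mono h (by omega)
  gcongr

/-- A disagreement at or before r forces a distance at least w(k,r)⁻¹. Strictness matters: where
w(k,·) stays constant, points that disagree by time r can be at distance exactly w(k,r)⁻¹. -/
theorem agree_of_dist_lt {k r : ℕ} (h : k ≤ r) {x y : S.Seq k}
    (hxy : dist x y < (S.w k r : ℝ)⁻¹) : x.word r = y.word r := by
  change seqDist x y < _ at hxy
  rw [Seq.word_eq_iff]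
  intro i hi hir
  by_contra hne
  have he : x ≠ y := by rintro rfl; exact hne rfl
  have hle := firstDiff_le hi hne
  have hk : 0 < S.w k r := w_pos h
  rw [seqDist, if_neg he] at hxy
  split_ifs at hxy with h2
  · exact absurd hxy (not_lt.2 (inv_le_one_of_one_le₀ (by exact_mod_cast hk)))
  · have hk' : k ≤ firstDiff x y - 1 := by
      obtain ⟨hi', hd⟩ := firstDiff_mem he
      have hne : firstDiff x y ≠ k := by
        intro h
        have key : ∀ j (hj : k ≤ j), j = k → x.letter j hj = y.letter j hj := by
          rintro j hj rfl
          simpa using h2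
        exact hd (key _ _ h)
      omega
    have h0 : 0 < S.w k (firstDiff x y - 1) := w_pos hk'
    have h1 : S.w k (firstDiff x y - 1) ≤ S.w k r := w_mono hk' (by omega)
    refine absurd hxy (not_lt.2 ?_)
    gcongr

theorem agree_of_dist_lt_one {k : ℕ} {x y : S.Seq k} (hxy : dist x y < 1) :
    x.letter k le_rfl = y.letter k le_rfl := by
  change seqDist x y < _ at hxy
  by_contra hne
  have he : x ≠ y := by rintro rfl; exact hne rfl
  rw [seqDist, if_neg he, if_pos hne] at hxy
  exact lt_irrefl _ hxy

/-- Cylinders of diameter less than `δ` exist over words whose number is bounded independently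
of the time. -/
theorem exists_uniform_small_cylinders (S : NSFT) {δ : ℝ} (hδ : 0 < δ) :
    ∃ C : ℕ, ∀ k, ∃ r, k ≤ r ∧ S.w k r ≤ C ∧
      ∀ x y : S.Seq k, x.word r = y.word r → dist x y < δ := by
  obtain ⟨B, hB⟩ := S.l_bdd
  have hB1 : 1 ≤ B := (S.l_pos 0).trans_le (hB 0)
  obtain ⟨M, hM⟩ := exists_nat_gt (1 / δ)
  have hM1 : 1 ≤ M := by
    have : (0 : ℝ) < M := (by positivity : 0 < 1 / δ).trans hM
    exact_mod_cast this
  -- M bounds the word count just before it passes 1/δ, and B bounds the growth caused by one more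
  -- letter.
  refine ⟨M * B, fun k => ?_⟩
  by_cases hk : ∃ r, k ≤ r ∧ 1 / δ < S.w k r
  · classical
    refine ⟨Nat.find hk, (Nat.find_spec hk).1, ?_, fun x y hxy => ?_⟩
    · obtain ⟨h1, h2⟩ := Nat.find_spec hk
      rcases h1.eq_or_lt with h | h
      · rw [← h]
        exact ((w_self_le k).trans (hB k)).trans (Nat.le_mul_of_pos_left _ hM1)
      · obtain ⟨r, hr⟩ : ∃ r, Nat.find hk = r + 1 := ⟨Nat.find hk - 1, by omega⟩
        have hlt := Nat.find_min hk (m := r) (by omega)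
        rw [hr]
        refine (w_succ_le hB (by omega)).trans (Nat.mul_le_mul_right _ ?_)
        push Not at hlt
        have := (hlt (by omega)).trans hM.le
        exact_mod_cast this
    · obtain ⟨h1, h2⟩ := Nat.find_spec hk
      refine (dist_le_of_agree h1 hxy).trans_lt ?_
      exact inv_lt_of_inv_lt₀ hδ ((one_div δ).symm.trans_lt h2)
  · push Not at hk
    have hbd : ∀ r, k ≤ r → S.w k r ≤ M := fun r hr => by
      have := (hk r hr).trans hM.le
      exact_mod_cast this
    -- If the word count never passes 1/δ, it attains a maximum; words no longer branch from there
    -- on, and the cylinders are single points.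
    obtain ⟨r, hr, hmax⟩ : ∃ r, k ≤ r ∧ ∀ s, k ≤ s → S.w k s ≤ S.w k r := by
      have hfin : (S.w k '' Set.Ici k).Finite :=
        (Set.finite_Iic M).subset (by rintro _ ⟨s, hs, rfl⟩; exact hbd s hs)
      obtain ⟨_, ⟨r, hr, rfl⟩, h⟩ := hfin.exists_maximal ⟨_, k, le_refl k, rfl⟩
      refine ⟨r, hr, fun s hs => ?_⟩
      by_contra hcon
      exact hcon (h ⟨s, hs, rfl⟩ (by omega))
    refine ⟨r, hr, (hbd r hr).trans (Nat.le_mul_of_pos_right _ hB1), fun x y hxy => ?_⟩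
    have hxy' : x = y := by
      apply seq_ext
      intro i hi
      by_cases hir : i ≤ r
      · exact Seq.word_eq_iff.1 hxy i hi hir
      -- Truncation to [k,r] is onto, and by maximality of r the source is no larger than the
      -- target.
      · have hinj : Function.Injective (fun z : S.Word k i => z.toSeq.word r) := by
          refine (Function.Surjective.bijective_of_nat_card_le ?_ (hmax i hi)).1
          intro z
          refine ⟨z.toSeq.word i, ?_⟩
          conv_rhs => rw [← z.word_toSeq]
          refine Seq.word_eq_iff.2 fun j hj hjr => ?_
          exact Word.extend_of_mem _ (i := j) ⟨hj, by omega⟩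
        have : x.word i = y.word i := by
          apply hinj
          change (x.word i).toSeq.word r = (y.word i).toSeq.word r
          refine Seq.word_eq_iff.2 fun j hj hjr => ?_
          have h1 := Word.extend_of_mem (x.word i) (i := j) ⟨hj, by omega⟩
          have h2 := Word.extend_of_mem (y.word i) (i := j) ⟨hj, by omega⟩
          exact h1.trans ((Seq.word_eq_iff.1 hxy j hj hjr).trans h2.symm)
        exact Seq.word_eq_iff.1 this i hi le_rfl
    rw [hxy', dist_self]
    exact hδ

end NSFT

/-! ### Matrix products as path counts. -/

namespace NSFT

open Filter

variable {S : NSFT}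

theorem matProd_self (k : ℕ) : S.matProd (le_refl k) = 1 := by
  simp [matProd]

theorem matProd_succ {k m : ℕ} (h : k ≤ m) :
    S.matProd (Nat.le_succ_of_le h) = S.matProd h * S.L m := by
  simp only [matProd]
  rw [Nat.leRec_succ]

/-- Appending an admissible letter to a word. -/
noncomputable def Word.snoc {k m : ℕ} (h : k ≤ m) (x : S.Word k m) (β : Fin (S.l (m + 1)))
    (hβ : S.L m (x.letter m ⟨h, le_rfl⟩) β = 1) : S.Word k (m + 1) :=
  ⟨fun i => Function.update x.extend (m + 1) β i, fun i h₁ h₂ => by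
    by_cases him : i = m
    · subst him
      have := x.extend_of_mem (i := i) ⟨h, le_rfl⟩
      simpa [this] using hβ
    · have h3 : i ≠ m + 1 := by omega
      have h4 : i + 1 ≠ m + 1 := by omega
      simpa only [Function.update_of_ne h3, Function.update_of_ne h4] using
        x.extend_admissible i h₁⟩

theorem Word.snoc_letter_last {k m : ℕ} (h : k ≤ m) (x : S.Word k m) (β : Fin (S.l (m + 1)))
    (hβ : S.L m (x.letter m ⟨h, le_rfl⟩) β = 1) (hm : m + 1 ∈ Set.Icc k (m + 1)) :
    (x.snoc h β hβ).letter (m + 1) hm = β :=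
  Function.update_self ..

theorem Word.snoc_letter_of_le {k m : ℕ} (h : k ≤ m) (x : S.Word k m) (β : Fin (S.l (m + 1)))
    (hβ : S.L m (x.letter m ⟨h, le_rfl⟩) β = 1) {i : ℕ} (hi : i ∈ Set.Icc k m)
    (hi' : i ∈ Set.Icc k (m + 1)) : (x.snoc h β hβ).letter i hi' = x.letter i hi := by
  have hne : i ≠ m + 1 := by have := hi.2; omega
  exact (Function.update_of_ne hne ..).trans (x.extend_of_mem hi)

/-- A word of length at least two is a shorter word together with an admissible last letter. -/
noncomputable def Word.equivSnoc {k m : ℕ} (h : k ≤ m) :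
    (Σ x : S.Word k m, {β : Fin (S.l (m + 1)) // S.L m (x.letter m ⟨h, le_rfl⟩) β = 1}) ≃
      S.Word k (m + 1) :=
  Equiv.ofBijective (fun p => p.1.snoc h p.2.1 p.2.2) <| by
    constructor
    · rintro ⟨x, β, hβ⟩ ⟨y, γ, hγ⟩ hxy
      have hxy : x.snoc h β hβ = y.snoc h γ hγ := hxy
      have hxy' : x = y := by
        refine Word.ext_letter fun i hi => ?_
        have hi' : i ∈ Set.Icc k (m + 1) := ⟨hi.1, Nat.le_succ_of_le hi.2⟩
        rw [← x.snoc_letter_of_le h β hβ hi hi', ← y.snoc_letter_of_le h γ hγ hi hi', hxy]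
      subst hxy'
      have hm : m + 1 ∈ Set.Icc k (m + 1) := ⟨by omega, le_rfl⟩
      obtain rfl : β = γ := by
        rw [← x.snoc_letter_last h β hβ hm, ← x.snoc_letter_last h γ hγ hm, hxy]
      rfl
    · intro y
      have hr : m + 1 ∈ Set.Icc k (m + 1) := ⟨by omega, le_rfl⟩
      refine ⟨⟨⟨fun i => y.1 ⟨i.1, i.2.1, Nat.le_succ_of_le i.2.2⟩,
        fun i h₁ h₂ => y.2 i h₁ (Nat.le_succ_of_le h₂)⟩, ⟨y.letter (m + 1) hr,
        y.2 m h le_rfl⟩⟩, ?_⟩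
      refine Word.ext_letter fun i hi => ?_
      by_cases him : i = m + 1
      · subst him
        exact Word.snoc_letter_last ..
      · exact Word.snoc_letter_of_le h _ _ _ ⟨hi.1, by have := hi.2; omega⟩ _

theorem sum_L_mul (m : ℕ) (α : Fin (S.l m)) (g : Fin (S.l (m + 1)) → ℝ) :
    ∑ β : {β // S.L m α β = 1}, g β = ∑ β, S.L m α β * g β := by
  classical
  have h1 : ∑ β, S.L m α β * g β = ∑ β, if S.L m α β = 1 then g β else 0 := by
    refine Finset.sum_congr rfl fun β _ => ?_
    rcases S.entries m α β with h | h <;> simp [h]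
  refine Eq.trans ?_ h1.symm
  rw [← Finset.sum_filter]
  exact (Finset.sum_subtype _ (by simp) g).symm

/-- The weight g lets the induction close: summing over the last letter replaces g by L_m g. The
choice g = 1 counts words. -/
theorem sum_word_last {k m : ℕ} (h : k ≤ m) (g : Fin (S.l m) → ℝ) :
    ∑ x : S.Word k m, g (x.letter m ⟨h, le_rfl⟩) = ∑ α, ∑ β, S.matProd h α β * g β := by
  induction m, h using Nat.le_induction with
  | base =>
    rw [matProd_self]
    simp only [Matrix.one_apply, ite_mul, one_mul, zero_mul, Finset.sum_ite_eq, Finset.mem_univ,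
      if_true]
    refine Fintype.sum_bijective (fun x : S.Word k k => x.letter k ⟨le_rfl, le_rfl⟩) ?_ _ _
      fun _ => rfl
    constructor
    · intro x y hxy
      refine Word.ext_letter ?_
      rintro i ⟨hi1, hi2⟩
      obtain rfl : i = k := le_antisymm hi2 hi1
      exact hxy
    · intro α
      let z : ∀ i, Fin (S.l i) := Function.update (fun i => ⟨0, S.l_pos i⟩) k α
      have hz : z k = α := Function.update_self ..
      exact ⟨⟨fun i => z i, fun i h₁ h₂ => by omega⟩, hz⟩
  | succ m hm ih =>
    classical
    rw [← (Word.equivSnoc hm).sum_comp, Fintype.sum_sigma]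
    have h1 : ∀ x : S.Word k m, ∑ β : {β // S.L m (x.letter m ⟨hm, le_rfl⟩) β = 1},
        g ((Word.equivSnoc hm ⟨x, β⟩).letter (m + 1) ⟨by omega, le_rfl⟩) =
        (fun α => ∑ β, S.L m α β * g β) (x.letter m ⟨hm, le_rfl⟩) := by
      intro x
      refine Eq.trans (Finset.sum_congr rfl fun β _ => ?_) (sum_L_mul m _ g)
      exact congrArg g (x.snoc_letter_last hm β.1 β.2 ⟨by omega, le_rfl⟩)
    refine (Finset.sum_congr rfl fun x _ => h1 x).trans
      ((ih fun α => ∑ β, S.L m α β * g β).trans ?_)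
    rw [matProd_succ hm]
    refine Finset.sum_congr rfl fun α _ => ?_
    simp only [Matrix.mul_apply, Finset.sum_mul, Finset.mul_sum]
    rw [Finset.sum_comm]
    simp only [mul_assoc]

/-- Integrality upgrades positive entries to entries at least 1. -/
theorem exists_nat_matProd {k m : ℕ} (h : k ≤ m) (α β) : ∃ n : ℕ, S.matProd h α β = n := by
  induction m, h using Nat.le_induction with
  | base =>
    rw [matProd_self, Matrix.one_apply]
    split_ifs
    · exact ⟨1, by simp⟩
    · exact ⟨0, by simp⟩
  | succ m hm ih =>
    choose f hf using ih
    have hL : ∀ γ, ∃ n : ℕ, S.L m γ β = n := fun γ => by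
      rcases S.entries m γ β with h | h
      · exact ⟨0, by simp [h]⟩
      · exact ⟨1, by simp [h]⟩
    choose e he using hL
    refine ⟨∑ γ, f γ * e γ, ?_⟩
    rw [matProd_succ hm, Matrix.mul_apply]
    push_cast
    exact Finset.sum_congr rfl fun γ _ => by rw [hf, he]

theorem matProd_nonneg {k m : ℕ} (h : k ≤ m) (α β) : 0 ≤ S.matProd h α β := by
  obtain ⟨n, hn⟩ := exists_nat_matProd h α β
  rw [hn]
  positivity

theorem one_le_matProd_of_pos {k m : ℕ} {h : k ≤ m} {α β} (hp : 0 < S.matProd h α β) :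
    1 ≤ S.matProd h α β := by
  obtain ⟨n, hn⟩ := exists_nat_matProd h α β
  rw [hn] at hp ⊢
  exact_mod_cast hp

theorem sumNorm_matProd {k m : ℕ} (h : k ≤ m) : sumNorm (S.matProd h) = S.w k m := by
  have := sum_word_last h (S := S) (fun _ => 1)
  simp only [mul_one, Finset.sum_const, nsmul_eq_mul] at this
  rw [w, Nat.card_eq_fintype_card, ← Finset.card_univ, this]
  simp only [sumNorm, abs_of_nonneg (matProd_nonneg h _ _)]

theorem matGrowth_eq (S : NSFT) :
    S.matGrowth = limsup (fun k : ℕ => ((Real.log (S.w 0 k) / k : ℝ) : EReal)) atTop := by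
  simp only [matGrowth, sumNorm_matProd]

/-! ### Growth of the eigenvector norms against growth of words. -/

section Eigen

variable {w' v' : ∀ i, Fin (S.l i) → ℝ}

theorem vecNorm_eq {n : ℕ} {u : Fin n → ℝ} (h : ∀ α, 0 < u α) : vecNorm u = ∑ α, u α :=
  Finset.sum_congr rfl fun α _ => abs_of_pos (h α)

theorem le_vecNorm {n : ℕ} (u : Fin n → ℝ) (α : Fin n) : u α ≤ vecNorm u :=
  (le_abs_self _).trans (Finset.single_le_sum (f := fun α => |u α|)
    (fun _ _ => abs_nonneg _) (Finset.mem_univ α))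

theorem vecNorm_pos (hw : S.IsColSeq w') (i : ℕ) : 0 < vecNorm (w' i) :=
  ((hw i).1 ⟨0, S.l_pos i⟩).trans_le (le_vecNorm _ _)

theorem eigenProd_eq (hw : S.IsColSeq w') {k m : ℕ} (h : k ≤ m) :
    eigenProd w' k m = vecNorm (w' k) / vecNorm (w' m) := by
  induction m, h using Nat.le_induction with
  | base => simp [eigenProd, (vecNorm_pos hw k).ne']
  | succ m hm ih =>
    have h0 := (vecNorm_pos hw m).ne'
    have h1 := (vecNorm_pos hw (m + 1)).ne'
    rw [eigenProd, Finset.prod_Ico_succ_top hm, ← eigenProd, ih, eigen]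
    field_simp

theorem colSeq_eq_matProd_mulVec (hw : S.IsColSeq w') {k m : ℕ} (h : k ≤ m) :
    w' k = (S.matProd h).mulVec (w' m) := by
  induction m, h using Nat.le_induction with
  | base => simp [matProd_self]
  | succ m hm ih => rw [matProd_succ hm, ← Matrix.mulVec_mulVec, ← (hw m).2, ih]

theorem colSeq_apply (hw : S.IsColSeq w') {k m : ℕ} (h : k ≤ m) (α : Fin (S.l k)) :
    w' k α = ∑ β, S.matProd h α β * w' m β := by
  conv_lhs => rw [colSeq_eq_matProd_mulVec hw h]
  rfl

theorem vecNorm_le_mul (hw : S.IsColSeq w') {k m : ℕ} (h : k ≤ m) :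
    vecNorm (w' k) ≤ S.w k m * vecNorm (w' m) := by
  rw [vecNorm_eq (hw k).1, ← sumNorm_matProd h, sumNorm, Finset.sum_mul]
  refine Finset.sum_le_sum fun α _ => ?_
  rw [colSeq_apply hw h, Finset.sum_mul]
  refine Finset.sum_le_sum fun β _ => ?_
  rw [abs_of_nonneg (matProd_nonneg h _ _)]
  exact mul_le_mul_of_nonneg_left (le_vecNorm _ _) (matProd_nonneg h _ _)

theorem vecNorm_le_of_one_le (hw : S.IsColSeq w') {k m : ℕ} (h : k ≤ m) {γ : Fin (S.l k)}
    (hγ : ∀ β, 1 ≤ S.matProd h γ β) : vecNorm (w' m) ≤ w' k γ := by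
  rw [vecNorm_eq (hw m).1, colSeq_apply hw h]
  exact Finset.sum_le_sum fun β _ => le_mul_of_one_le_left ((hw m).1 β).le (hγ β)

/-- Since no column of L_i vanishes, every coordinate of ŵ_{i+1} occurs in some coordinate of ŵ_i.
Consequently λ_i ≥ 1. -/
theorem vecNorm_antitone_succ (hw : S.IsColSeq w') (i : ℕ) :
    vecNorm (w' (i + 1)) ≤ vecNorm (w' i) := by
  rw [vecNorm_eq (hw i).1, vecNorm_eq (hw (i + 1)).1]
  have h1 : ∀ α, w' i α = ∑ β, S.L i α β * w' (i + 1) β := fun α => congrFun (hw i).2 α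
  simp only [h1]
  rw [Finset.sum_comm]
  refine Finset.sum_le_sum fun β _ => ?_
  obtain ⟨α, hα⟩ := S.col_ne_zero i β
  have hα1 := (S.entries _ _ _).resolve_left hα
  calc w' (i + 1) β = S.L i α β * w' (i + 1) β := by rw [hα1, one_mul]
    _ ≤ _ := Finset.single_le_sum (f := fun α => S.L i α β * w' (i + 1) β)
        (fun α _ => mul_nonneg (L_nonneg _ _ _) ((hw (i + 1)).1 β).le) (Finset.mem_univ α)

theorem vecNorm_anti (hw : S.IsColSeq w') {k m : ℕ} (h : k ≤ m) :
    vecNorm (w' m) ≤ vecNorm (w' k) :=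
  antitone_nat_of_succ_le (f := fun i => vecNorm (w' i)) (vecNorm_antitone_succ hw) h

theorem one_le_eigenProd (hw : S.IsColSeq w') {k m : ℕ} (h : k ≤ m) : 1 ≤ eigenProd w' k m := by
  rw [eigenProd_eq hw h, one_le_div (vecNorm_pos hw m)]
  exact vecNorm_anti hw h

theorem eigenProd_le (hw : S.IsColSeq w') {k m : ℕ} (h : k ≤ m) : eigenProd w' k m ≤ S.w k m := by
  rw [eigenProd_eq hw h, div_le_iff₀ (vecNorm_pos hw m)]
  exact vecNorm_le_mul hw h

theorem w_le_pow {B : ℕ} (hB : ∀ i, S.l i ≤ B) (k n : ℕ) : S.w k (k + n) ≤ B ^ (n + 1) := by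
  induction n with
  | zero => simpa using (w_self_le k).trans (hB k)
  | succ n ih => exact (w_succ_le hB (Nat.le_add_right k _)).trans (Nat.mul_le_mul_right _ ih)

/-- If some letter `γ` with maximal column sum is connected to all letters at a later time `n`,
then `‖L^{(0,k)}‖` is bounded by `λ^{(0,k)} λ^{(k,n)}` up to a constant. -/
theorem w_le_eigenProd_mul (hw : S.IsColSeq w') {B : ℕ} (hB : ∀ i, S.l i ≤ B) {k n : ℕ}
    (h : k ≤ n) {γ : Fin (S.l k)} (hmax : S.IsMaxCol k γ) (hγ : ∀ β, 1 ≤ S.matProd h γ β) :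
    (S.w 0 k : ℝ) ≤ B * (eigenProd w' 0 k * eigenProd w' k n) := by
  set s := ∑ α, S.matProd (Nat.zero_le k) α γ
  have hs : 0 ≤ s := Finset.sum_nonneg fun α _ => matProd_nonneg _ _ _
  have h1 : (S.w 0 k : ℝ) ≤ B * s := by
    rw [← sumNorm_matProd (Nat.zero_le k), sumNorm, Finset.sum_comm]
    calc ∑ β, ∑ α, |S.matProd (Nat.zero_le k) α β|
        = ∑ β, ∑ α, S.matProd (Nat.zero_le k) α β := by
          simp only [abs_of_nonneg (matProd_nonneg _ _ _)]
      _ ≤ ∑ _β : Fin (S.l k), s := Finset.sum_le_sum fun β _ => hmax β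
      _ = S.l k * s := by simp
      _ ≤ B * s := mul_le_mul_of_nonneg_right (by exact_mod_cast hB k) hs
  -- Only the contribution of γ to ŵ_0 = L^{(0,k)} ŵ_k is kept, with ŵ_k(γ) ≥ ‖ŵ_n‖.
  have h2 : s * vecNorm (w' n) ≤ vecNorm (w' 0) := by
    rw [vecNorm_eq (hw 0).1, Finset.sum_mul]
    refine Finset.sum_le_sum fun α _ => ?_
    rw [colSeq_apply hw (Nat.zero_le k)]
    calc _ ≤ S.matProd (Nat.zero_le k) α γ * w' k γ :=
          mul_le_mul_of_nonneg_left (vecNorm_le_of_one_le hw h hγ) (matProd_nonneg _ _ _)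
      _ ≤ _ := Finset.single_le_sum (f := fun β => S.matProd (Nat.zero_le k) α β * w' k β)
          (fun β _ => mul_nonneg (matProd_nonneg _ _ _) ((hw k).1 β).le) (Finset.mem_univ γ)
  have h3 : eigenProd w' 0 k * eigenProd w' k n = vecNorm (w' 0) / vecNorm (w' n) := by
    have := (vecNorm_pos hw k).ne'
    rw [eigenProd_eq hw (Nat.zero_le k), eigenProd_eq hw h]
    field_simp
  rw [h3]
  refine h1.trans (mul_le_mul_of_nonneg_left ?_ (by positivity))
  rw [le_div_iff₀ (vecNorm_pos hw n)]
  exact h2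

theorem exists_isMaxCol (k : ℕ) : ∃ γ, S.IsMaxCol k γ := by
  have : Nonempty (Fin (S.l k)) := ⟨⟨0, S.l_pos k⟩⟩
  exact Finite.exists_max _

/-- Primitivity makes the set of candidates nonempty, so its infimum is attained and is not the
default value 0. -/
theorem IsPrimitive.primIndex_spec (h : S.IsPrimitive) (k : ℕ) :
    ∀ α β, 0 < S.matProd (Nat.le_add_right k (S.primIndex k)) α β := by
  have hne : {n | 1 ≤ n ∧ ∀ α β, 0 < S.matProd (Nat.le_add_right k n) α β}.Nonempty := by
    obtain ⟨n, hn, hp⟩ := h k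
    obtain ⟨d, rfl⟩ := Nat.exists_eq_add_of_lt hn
    exact ⟨d + 1, by omega, hp⟩
  exact (Nat.sInf_mem hne).2

/-- If `‖L^{(0,k)}‖ ≤ C λ^{(0,k)} e_k` with `e_k` subexponential, then the growth rates agree. -/
theorem matGrowth_le_eigenGrowth_of_le (hw : S.IsColSeq w') {C : ℝ} {e : ℕ → ℝ}
    (h1 : ∀ k, 1 ≤ e k)
    (h : ∀ᶠ k in atTop, (S.w 0 k : ℝ) ≤ C * (eigenProd w' 0 k * e k))
    (he : limsup (fun k : ℕ => ((Real.log (e k) / k : ℝ) : EReal)) atTop ≤ 0) :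
    S.matGrowth ≤ S.eigenGrowth w' := by
  rw [matGrowth_eq]
  refine limsup_div_le_limsup_div fun η hη => ⟨Real.log C, ?_⟩
  have hev := eventually_lt_of_limsup_lt (he.trans_lt (show (0 : EReal) < (η : ℝ) by
    exact_mod_cast hη))
  filter_upwards [h, hev, eventually_gt_atTop 0] with k hk hek hk0
  have hek' : Real.log (e k) / k < η := by exact_mod_cast hek
  rw [div_lt_iff₀ (by exact_mod_cast hk0)] at hek'
  have hl := one_le_eigenProd hw (Nat.zero_le k)
  have h1k := h1 k
  have hwk : (0 : ℝ) < S.w 0 k := by exact_mod_cast w_pos (Nat.zero_le k)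
  -- Positivity is forced by w(0,k) > 0 and allows the logarithm of the product to be split.
  have hC : 0 < C := by
    by_contra hC
    have : C * (eigenProd w' 0 k * e k) ≤ 0 :=
      mul_nonpos_of_nonpos_of_nonneg (not_lt.1 hC) (by positivity)
    linarith
  have := Real.log_le_log hwk hk
  rw [Real.log_mul (by positivity) (by positivity), Real.log_mul (by positivity) (by positivity)]
    at this
  linarith

theorem matGrowth_le_of_eigenPrimGrowth (hprim : S.IsPrimitive) (hw : S.IsColSeq w')
    (h : S.eigenPrimGrowth w' = 0) : S.matGrowth ≤ S.eigenGrowth w' := by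
  obtain ⟨B, hB⟩ := S.l_bdd
  refine matGrowth_le_eigenGrowth_of_le hw (C := B)
    (e := fun k => eigenProd w' k (k + S.primIndex k))
    (fun k => one_le_eigenProd hw (by omega)) (Eventually.of_forall fun k => ?_) h.le
  obtain ⟨γ, hγ⟩ := exists_isMaxCol (S := S) k
  exact w_le_eigenProd_mul hw hB (by omega) hγ
    fun β => one_le_matProd_of_pos (hprim.primIndex_spec k γ β)

theorem matGrowth_le_of_bestReceiversBroadcast (hprim : S.IsPrimitive) (hw : S.IsColSeq w')
    (h : S.BestReceiversBroadcast) : S.matGrowth ≤ S.eigenGrowth w' := by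
  obtain ⟨B, hB⟩ := S.l_bdd
  obtain ⟨ε, hε, k₀, hk₀⟩ := h
  obtain ⟨M, hM⟩ := exists_nat_gt (1 / ε)
  have hM1 : 1 ≤ M := by
    have : (0 : ℝ) < M := (by positivity : 0 < 1 / ε).trans hM
    exact_mod_cast this
  have hB1 : 1 ≤ B := (S.l_pos 0).trans_le (hB 0)
  refine matGrowth_le_eigenGrowth_of_le hw (C := B * (M * B : ℕ)) (e := fun _ => 1)
    (fun _ => le_rfl) ?_ (by simp)
  filter_upwards [eventually_ge_atTop k₀] with k hk
  obtain ⟨γ, hγ⟩ := exists_isMaxCol (S := S) k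
  -- The time n is the first at which the word count passes 1/ε, where the hypothesis applies. If it
  -- never does, primitivity connects γ to all letters while the count is still at most M.
  obtain ⟨n, hkn, hn, hγn⟩ : ∃ (n : ℕ) (h : k ≤ n), S.w k n ≤ M * B ∧
      ∀ β, 1 ≤ S.matProd h γ β := by
    by_cases hex : ∃ m, 1 / ε < (S.w k (k + m) : ℝ)
    · classical
      refine ⟨k + Nat.find hex, by omega, ?_, hk₀ k hk _ (Nat.find_spec hex) γ hγ⟩
      rcases Nat.eq_zero_or_pos (Nat.find hex) with h0 | h0
      · rw [h0]
        exact ((w_self_le k).trans (hB k)).trans (Nat.le_mul_of_pos_left _ hM1)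
      · obtain ⟨r, hr⟩ : ∃ r, Nat.find hex = r + 1 := ⟨Nat.find hex - 1, by omega⟩
        have hlt := Nat.find_min hex (m := r) (by omega)
        rw [hr]
        refine (w_succ_le hB (Nat.le_add_right k _)).trans (Nat.mul_le_mul_right _ ?_)
        have := (not_lt.1 hlt).trans hM.le
        exact_mod_cast this
    · push Not at hex
      refine ⟨k + S.primIndex k, by omega, ?_,
        fun β => one_le_matProd_of_pos (hprim.primIndex_spec k γ β)⟩
      have : S.w k (k + S.primIndex k) ≤ M := by
        have := (hex (S.primIndex k)).trans hM.le
        exact_mod_cast this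
      exact this.trans (Nat.le_mul_of_pos_right _ hB1)
  have h1 := w_le_eigenProd_mul hw hB hkn hγ hγn
  have h2 : eigenProd w' k n ≤ (M * B : ℕ) := (eigenProd_le hw hkn).trans (by exact_mod_cast hn)
  have h3 := one_le_eigenProd hw (Nat.zero_le k)
  calc (S.w 0 k : ℝ) ≤ B * (eigenProd w' 0 k * eigenProd w' k n) := h1
    _ ≤ B * (eigenProd w' 0 k * (M * B : ℕ)) := by gcongr
    _ = _ := by ring

/-- With N bounding all N_k, 1 ≤ λ^{(k,k+N_k)} ≤ w(k,k+N_k) ≤ B^{N+1}, a bound independent of k. -/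
theorem eigenPrimGrowth_eq_zero (hw : S.IsColSeq w') (h : S.IsUniformlyPrimitive) :
    S.eigenPrimGrowth w' = 0 := by
  obtain ⟨B, hB⟩ := S.l_bdd
  obtain ⟨-, N, hN⟩ := h
  have hB1 : 1 ≤ B := (S.l_pos 0).trans_le (hB 0)
  have h0 : Tendsto (fun k : ℕ => Real.log (eigenProd w' k (k + S.primIndex k)) / k) atTop
      (nhds 0) := by
    refine squeeze_zero (fun k => ?_) (fun k => ?_)
      (tendsto_const_div_atTop_nhds_zero_nat (Real.log ((B : ℝ) ^ (N + 1))))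
    · exact div_nonneg (Real.log_nonneg (one_le_eigenProd hw (by omega))) (by positivity)
    · have h1 := one_le_eigenProd hw (show k ≤ k + S.primIndex k by omega)
      have h2 : eigenProd w' k (k + S.primIndex k) ≤ (B : ℝ) ^ (N + 1) := by
        refine (eigenProd_le hw (by omega)).trans ?_
        have := (w_le_pow hB k (S.primIndex k)).trans
          (Nat.pow_le_pow_right hB1 (Nat.succ_le_succ (hN k)))
        exact_mod_cast this
      have := Real.log_le_log (by linarith) h2
      gcongr
  exact ((continuous_coe_real_ereal.tendsto 0).comp h0).limsup_eq

end Eigen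

end NSFT

/-! ### Topological entropy equals the growth rate of words. -/

theorem ennreal_log_natCast_div {N : ℕ} (hN : 0 < N) (n : ℕ) :
    ENNReal.log (((N : ℕ∞) : ENNReal)) / (n : EReal) = ((Real.log N / n : ℝ) : EReal) := by
  have h : ENNReal.log (((N : ℕ∞) : ENNReal)) = ((Real.log N : ℝ) : EReal) := by
    rw [ENat.toENNReal_coe, ENNReal.log_pos_real (by exact_mod_cast hN.ne') (by simp)]
    simp
  rw [h, EReal.coe_div]
  simp

namespace NSFT

open Filter NDS

variable {S : NSFT}

/-- Letters carry absolute indices, so shifting only forgets the letters before n. -/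
theorem iter_letter (n : ℕ) (x : S.Seq 0) (i : ℕ) (h : n ≤ i) :
    (iter S.shift n x).letter i h = x.letter i (Nat.zero_le i) := by
  induction n with
  | zero => rfl
  | succ n ih => exact ih (by omega)

theorem iter_word_eq {n m : ℕ} {x y : S.Seq 0} (h : x.word m = y.word m) :
    (iter S.shift n x).word m = (iter S.shift n y).word m := by
  rw [Seq.word_eq_iff] at h ⊢
  intro i hi him
  rw [iter_letter, iter_letter]
  exact h i _ him

theorem Seq.word_eq_of_le {k m r : ℕ} (hmr : m ≤ r) {x y : S.Seq k} (h : x.word r = y.word r) :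
    x.word m = y.word m := by
  rw [Seq.word_eq_iff] at h ⊢
  exact fun i hi him => h i hi (him.trans hmr)

theorem isOpen_of_word {k r : ℕ} (hr : k ≤ r) {A : Set (S.Seq k)}
    (h : ∀ x y, x.word r = y.word r → x ∈ A → y ∈ A) : IsOpen A := by
  rw [Metric.isOpen_iff]
  intro x hx
  have hw : 0 < S.w k r := w_pos hr
  refine ⟨(S.w k r : ℝ)⁻¹, by positivity, fun y hy => ?_⟩
  exact h x y (agree_of_dist_lt hr (Metric.mem_ball'.1 hy)) hx

/-- The admissible sequences form a closed subset of a product of finite discrete spaces. The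
identity from the product topology to the metric is continuous because small cylinders depend on
finitely many letters. -/
instance compactSpace_seq (k : ℕ) : CompactSpace (S.Seq k) := by
  let K : Set (∀ i : Set.Ici k, Fin (S.l i)) :=
    {x | ∀ (i : ℕ) (h : k ≤ i), S.L i (x ⟨i, h⟩) (x ⟨i + 1, Nat.le_succ_of_le h⟩) = 1}
  have hK : IsClosed K := by
    simp only [K, Set.ofPred_forall]
    refine isClosed_iInter fun i => isClosed_iInter fun h => ?_
    have hc : Continuous fun x : ∀ i : Set.Ici k, Fin (S.l i) =>
        S.L i (x ⟨i, h⟩) (x ⟨i + 1, Nat.le_succ_of_le h⟩) := by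
      have h2 : Continuous fun p : Fin (S.l i) × Fin (S.l (i + 1)) => S.L i p.1 p.2 :=
        continuous_of_discreteTopology
      have h3 : Continuous fun x : ∀ i : Set.Ici k, Fin (S.l i) =>
          ((x ⟨i, h⟩, x ⟨i + 1, Nat.le_succ_of_le h⟩) : Fin (S.l i) × Fin (S.l (i + 1))) :=
        (continuous_apply (⟨i, h⟩ : Set.Ici k)).prodMk
          (continuous_apply (⟨i + 1, Nat.le_succ_of_le h⟩ : Set.Ici k))
      exact h2.comp h3
    exact isClosed_eq hc continuous_const
  have : CompactSpace K := isCompact_iff_compactSpace.1 hK.isCompact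
  let F : K → S.Seq k := fun x => ⟨x.1, x.2⟩
  have hF : Continuous F := by
    rw [continuous_iff_continuousAt]
    intro x
    rw [ContinuousAt, Metric.tendsto_nhds]
    intro δ hδ
    obtain ⟨C, hC⟩ := S.exists_uniform_small_cylinders hδ
    obtain ⟨r, hr, -, h⟩ := hC k
    have hev : ∀ᶠ y : K in nhds x, ∀ i : Set.Icc k r, y.1 ⟨i, i.2.1⟩ = x.1 ⟨i, i.2.1⟩ := by
      rw [eventually_all]
      intro i
      have hc : Continuous fun y : K => y.1 ⟨i.1, i.2.1⟩ :=
        (continuous_apply _).comp continuous_subtype_val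
      exact hc.continuousAt.eventually (p := fun z => z = x.1 ⟨i.1, i.2.1⟩)
        (by rw [nhds_discrete]; simp)
    filter_upwards [hev] with y hy
    refine h _ _ (Seq.word_eq_iff.2 fun i hi hir => ?_)
    exact hy ⟨i, hi, hir⟩
  have hsurj : Function.Surjective F := fun x => ⟨⟨x.1, x.2⟩, rfl⟩
  exact hsurj.compactSpace hF

/-- For n > 0, the largest endpoint r_j with j < n serves all times; cutting its words at j gives
w(0,j)·w(j,r_j). Looking past time n thus costs a constant factor, however far r_j lies. -/
theorem exists_common_end {r : ℕ → ℕ} (hr : ∀ i, i ≤ r i) {C : ℕ} (hC : ∀ i, S.w i (r i) ≤ C)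
    (n : ℕ) : ∃ R, (∀ i < n, r i ≤ R) ∧ S.w 0 R ≤ S.w 0 n * C := by
  have hC1 : 1 ≤ C := (w_pos (hr 0)).trans_le (hC 0)
  rcases Nat.eq_zero_or_pos n with rfl | hn
  · exact ⟨0, by simp, Nat.le_mul_of_pos_right _ hC1⟩
  · obtain ⟨j, hj, hmax⟩ := (Finset.range n).exists_max_image r ⟨0, by simpa using hn⟩
    rw [Finset.mem_range] at hj
    refine ⟨r j, fun i hi => hmax i (by simpa using hi), ?_⟩
    exact (w_le_mul 0 j j (r j) (Nat.zero_le _) (Nat.le_succ j)).trans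
      (Nat.mul_le_mul (w_mono (Nat.zero_le _) hj.le) (hC j))

theorem log_w_le {n R C : ℕ} (hR : S.w 0 R ≤ S.w 0 n * C) :
    Real.log (S.w 0 R) ≤ Real.log (S.w 0 n) + Real.log C := by
  have h1 : 0 < S.w 0 R := w_pos (Nat.zero_le _)
  have h2 : 0 < S.w 0 n := w_pos (Nat.zero_le _)
  have hC : 0 < C := by
    by_contra h
    obtain rfl : C = 0 := by omega
    omega
  rw [← Real.log_mul (by positivity) (by positivity)]
  exact Real.log_le_log (by positivity) (by exact_mod_cast hR)

/-- One member of the join suffices per R-word: at each time the orbit of the cylinder stays in the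
δ-ball about the orbit of a representative, and this ball lies in one member of the cover. -/
theorem coverNumber_coverJoin_le {U : ∀ n, Set (Set (S.Seq n))} {δ : ℝ}
    (hU : ∀ n, ∀ x : S.Seq n, ∃ A ∈ U n, Metric.ball x δ ⊆ A) {n R : ℕ}
    (hR : ∀ i < n, ∀ x y : S.Seq i, x.word R = y.word R → dist x y < δ) :
    coverNumber (coverJoin S.shift U n) ≤ (S.w 0 R : ℕ∞) := by
  choose A hA hball using hU
  let V : S.Word 0 R → Set (S.Seq 0) := fun z =>
    ⋂ i ∈ Set.Iio n, iter S.shift i ⁻¹' A i (iter S.shift i z.toSeq)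
  have hcover : Set.range V ⊆ coverJoin S.shift U n ∧ ⋃₀ Set.range V = Set.univ := by
    constructor
    · rintro _ ⟨z, rfl⟩
      exact ⟨fun i => A i (iter S.shift i z.toSeq), fun i _ => hA _ _, rfl⟩
    · refine Set.eq_univ_of_forall fun y => ⟨V (y.word R), ⟨_, rfl⟩, ?_⟩
      simp only [V, Set.mem_iInter]
      intro i hi
      apply hball
      rw [Metric.mem_ball]
      exact hR i hi _ _ (iter_word_eq (Word.word_toSeq _).symm)
  refine (iInf₂_le (Set.range V) hcover).trans ?_
  rw [← Set.image_univ]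
  refine (Set.encard_image_le _ _).trans ?_
  rw [Set.encard_univ, ENat.card_eq_coe_natCard, w]

theorem topEntropy_le_matGrowth (S : NSFT) : topEntropy S.shift ≤ S.matGrowth := by
  refine iSup₂_le fun U hU => ?_
  obtain ⟨-, δ, hδ, hball⟩ := hU
  obtain ⟨C, hC⟩ := S.exists_uniform_small_cylinders hδ
  choose r hr hrC hrδ using hC
  choose R hR hRC using exists_common_end hr hrC
  calc topEntropyOn S.shift U
      ≤ limsup (fun n : ℕ => ((Real.log (S.w 0 (R n)) / n : ℝ) : EReal)) atTop := by
        refine limsup_le_limsup (Eventually.of_forall fun n => ?_)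
        dsimp only
        rw [← ennreal_log_natCast_div (w_pos (Nat.zero_le _))]
        refine EReal.div_le_div_right_of_nonneg (by simp) (ENNReal.log_monotone ?_)
        exact ENat.toENNReal_le.2 (coverNumber_coverJoin_le hball fun i hi x y hxy =>
          hrδ i x y (Seq.word_eq_of_le (hR n i hi) hxy))
    _ ≤ S.matGrowth := by
        rw [matGrowth_eq]
        refine limsup_div_le_limsup_div fun η hη => ⟨Real.log C, Eventually.of_forall fun n => ?_⟩
        have : 0 ≤ η * n := by positivity
        linarith [log_w_le (hRC n)]

/-- The open cover by the cylinders of length one. -/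
def letterCover (S : NSFT) (n : ℕ) : Set (Set (S.Seq n)) :=
  Set.range fun α => {x : S.Seq n | x.letter n le_rfl = α}

theorem isOpen_letter_eq (n : ℕ) (α : Fin (S.l n)) :
    IsOpen {x : S.Seq n | x.letter n le_rfl = α} :=
  isOpen_of_word le_rfl fun _ _ h hx => (Seq.word_eq_iff.1 h n le_rfl le_rfl).symm.trans hx

theorem isLebesgueCoverSeq_letterCover (S : NSFT) : IsLebesgueCoverSeq S.letterCover := by
  refine ⟨fun n => ⟨?_, Set.eq_univ_of_forall fun x => ⟨_, ⟨x.letter n le_rfl, rfl⟩, rfl⟩⟩,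
    1, one_pos, fun n x => ⟨_, ⟨x.letter n le_rfl, rfl⟩, fun y hy =>
      agree_of_dist_lt_one (Metric.mem_ball.1 hy)⟩⟩
  rintro _ ⟨α, rfl⟩
  exact isOpen_letter_eq n α

/-- A member of the join fixes the letters at times 0, …, n, so distinct words need distinct
members. These are n + 1 covers. -/
theorem le_coverNumber_letterCover (n : ℕ) :
    (S.w 0 n : ℕ∞) ≤ coverNumber (coverJoin S.shift S.letterCover (n + 1)) := by
  refine le_iInf₂ fun D hD => ?_
  have hmem : ∀ z : S.Word 0 n, ∃ V ∈ D, z.toSeq ∈ V := fun z => by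
    have : z.toSeq ∈ ⋃₀ D := hD.2 ▸ Set.mem_univ _
    exact this
  choose V hVD hV using hmem
  have hinj : Function.Injective V := by
    intro z z' h
    obtain ⟨A, hA, hVA⟩ := hD.1 (hVD z)
    have h1 := hV z
    have h2 : z'.toSeq ∈ V z := h ▸ hV z'
    rw [hVA] at h1 h2
    rw [← z.word_toSeq, ← z'.word_toSeq, Seq.word_eq_iff]
    intro i hi hin
    simp only [Set.mem_iInter, Set.mem_Iio, Set.mem_preimage] at h1 h2
    obtain ⟨α, hα⟩ := hA i (by omega)
    have h3 := h1 i (by omega)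
    have h4 := h2 i (by omega)
    rw [← hα, Set.mem_ofPred_eq, iter_letter] at h3 h4
    rw [h3, h4]
  rw [w, ← ENat.card_eq_coe_natCard, ← Set.encard_univ, ← hinj.encard_image]
  refine Set.encard_le_encard ?_
  rintro _ ⟨z, -, rfl⟩
  exact hVD z

theorem matGrowth_le_topEntropy (S : NSFT) : S.matGrowth ≤ topEntropy S.shift := by
  obtain ⟨B, hB⟩ := S.l_bdd
  refine le_trans ?_ (le_iSup₂_of_le S.letterCover S.isLebesgueCoverSeq_letterCover le_rfl)
  rw [matGrowth_eq]
  -- The join of n letter covers sees words ending at n - 1; the missing letter costs at most a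
  -- factor B.
  calc _ ≤ limsup (fun n : ℕ => ((Real.log (S.w 0 (n - 1)) / n : ℝ) : EReal)) atTop := by
        refine limsup_div_le_limsup_div fun η hη => ⟨Real.log B, ?_⟩
        filter_upwards [eventually_gt_atTop 0] with n hn
        obtain ⟨m, rfl⟩ : ∃ m, n = m + 1 := ⟨n - 1, by omega⟩
        have h1 : 0 < S.w 0 (m + 1) := w_pos (Nat.zero_le _)
        have h2 : 0 < S.w 0 m := w_pos (Nat.zero_le _)
        have hB1 : 0 < B := (S.l_pos 0).trans_le (hB 0)
        have h3 : Real.log (S.w 0 (m + 1)) ≤ Real.log (S.w 0 m) + Real.log B := by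
          rw [← Real.log_mul (by positivity) (by positivity)]
          exact Real.log_le_log (by positivity) (by exact_mod_cast w_succ_le hB (Nat.zero_le m))
        have : 0 ≤ η * (m + 1 : ℕ) := by positivity
        rw [Nat.add_sub_cancel]
        linarith
    _ ≤ topEntropyOn S.shift S.letterCover := by
        refine limsup_le_limsup ?_
        filter_upwards [eventually_gt_atTop 0] with n hn
        obtain ⟨m, rfl⟩ : ∃ m, n = m + 1 := ⟨n - 1, by omega⟩
        rw [Nat.add_sub_cancel, ← ennreal_log_natCast_div (w_pos (Nat.zero_le _))]
        exact EReal.div_le_div_right_of_nonneg (by positivity)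
          (ENNReal.log_monotone (ENat.toENNReal_le.2 (le_coverNumber_letterCover m)))

theorem topEntropy_eq_matGrowth (S : NSFT) : topEntropy S.shift = S.matGrowth :=
  le_antisymm S.topEntropy_le_matGrowth S.matGrowth_le_topEntropy

end NSFT

/-! ### Shannon entropy of finitely valued functions. -/

namespace NDS

open MeasureTheory

/-- Gibbs' inequality. -/
theorem sum_negMulLog_le {ι : Type*} [Fintype ι] {p q : ι → ℝ} (hp : ∀ i, 0 ≤ p i)
    (hq : ∀ i, 0 ≤ q i) (hpq : ∀ i, p i ≠ 0 → q i ≠ 0) (hs : ∑ i, q i ≤ ∑ i, p i) :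
    ∑ i, Real.negMulLog (p i) ≤ ∑ i, -(p i * Real.log (q i)) := by
  -- This is log t ≤ t - 1 at t = q/p, multiplied by p.
  have key : ∀ i, Real.negMulLog (p i) ≤ -(p i * Real.log (q i)) + (q i - p i) := by
    intro i
    by_cases h : p i = 0
    · simpa [h] using hq i
    · have hp' : 0 < p i := (hp i).lt_of_ne' h
      have hq' : 0 < q i := (hq i).lt_of_ne' (hpq i h)
      have h1 := Real.log_le_sub_one_of_pos (div_pos hq' hp')
      rw [Real.log_div hq'.ne' hp'.ne'] at h1
      have h2 := mul_le_mul_of_nonneg_left h1 hp'.le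
      have h3 : p i * (q i / p i - 1) = q i - p i := by field_simp
      rw [Real.negMulLog]
      linarith
  calc _ ≤ ∑ i, (-(p i * Real.log (q i)) + (q i - p i)) := Finset.sum_le_sum fun i _ => key i
    _ = ∑ i, -(p i * Real.log (q i)) + (∑ i, q i - ∑ i, p i) := by
      rw [Finset.sum_add_distrib, Finset.sum_sub_distrib]
    _ ≤ _ := by linarith

section

universe u

variable {Ω : Type u} [MeasurableSpace Ω] (μ : Measure Ω)

/-- The Shannon entropy of a function with finitely many values. -/
noncomputable def labelEntropy {ι : Type} [Fintype ι] (f : Ω → ι) : ℝ :=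
  shannonEntropy μ fun a => f ⁻¹' {a}

variable [IsProbabilityMeasure μ]

theorem sum_measureReal_label {ι : Type} [Fintype ι] {f : Ω → ι}
    (hf : ∀ a, MeasurableSet (f ⁻¹' {a})) : ∑ a, μ.real (f ⁻¹' {a}) = 1 := by
  rw [sum_measureReal_preimage_singleton _ fun a _ => hf a]
  simp

/-- Gibbs' inequality against the uniform distribution. -/
theorem labelEntropy_le_log_card {ι : Type} [Fintype ι] {f : Ω → ι}
    (hf : ∀ a, MeasurableSet (f ⁻¹' {a})) :
    labelEntropy μ f ≤ Real.log (Fintype.card ι) := by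
  have h1 := sum_measureReal_label μ hf
  have hne : Nonempty ι := by
    by_contra h
    rw [not_nonempty_iff] at h
    simp at h1
  have hc : (0 : ℝ) < Fintype.card ι := by exact_mod_cast Fintype.card_pos
  refine (sum_negMulLog_le (q := fun _ => (Fintype.card ι : ℝ)⁻¹) (fun _ => measureReal_nonneg)
    (fun _ => by positivity) (fun _ _ => by positivity) ?_).trans ?_
  · rw [h1]
    simp [hc.ne']
  · simp only [Real.log_inv, mul_neg, neg_neg, ← Finset.sum_mul, h1, one_mul, le_refl]

theorem neg_log_le_labelEntropy {ι : Type} [Fintype ι] {f : Ω → ι}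
    (hf : ∀ a, MeasurableSet (f ⁻¹' {a})) {b : ℝ} (hb : ∀ a, μ.real (f ⁻¹' {a}) ≤ b) :
    -Real.log b ≤ labelEntropy μ f := by
  calc -Real.log b = ∑ a, -(μ.real (f ⁻¹' {a}) * Real.log b) := by
        rw [Finset.sum_neg_distrib, ← Finset.sum_mul, sum_measureReal_label μ hf, one_mul]
    _ ≤ _ := Finset.sum_le_sum fun a _ => ?_
  rw [Real.negMulLog, neg_mul]
  rcases (measureReal_nonneg (μ := μ) (s := f ⁻¹' {a})).eq_or_lt with h0 | h0
  · simp [← h0]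
  · have := Real.log_le_log h0 (hb a)
    gcongr

theorem measureReal_preimage_comp {ι κ : Type} [Fintype κ] [DecidableEq ι] {f : Ω → κ}
    (hf : ∀ a, MeasurableSet (f ⁻¹' {a})) (φ : κ → ι) (a : ι) :
    μ.real (φ ∘ f ⁻¹' {a}) = ∑ b with φ b = a, μ.real (f ⁻¹' {b}) := by
  rw [sum_measureReal_preimage_singleton _ fun b _ => hf b]
  congr 1
  ext x
  simp

/-- Each atom of f has at most the mass of the atom of `φ ∘ f` containing it, so its information
-log μ is at least as large. -/
theorem labelEntropy_comp_le {ι κ : Type} [Fintype κ] [Fintype ι] {f : Ω → κ}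
    (hf : ∀ a, MeasurableSet (f ⁻¹' {a})) (φ : κ → ι) :
    labelEntropy μ (φ ∘ f) ≤ labelEntropy μ f := by
  classical
  have hfib : labelEntropy μ f = ∑ a, ∑ b with φ b = a, Real.negMulLog (μ.real (f ⁻¹' {b})) :=
    (Finset.sum_fiberwise _ _ _).symm
  rw [hfib]
  refine Finset.sum_le_sum fun a _ => ?_
  have hsum := measureReal_preimage_comp μ hf φ a
  have h1 : Real.negMulLog (μ.real (φ ∘ f ⁻¹' {a})) =
      ∑ b with φ b = a, -(μ.real (f ⁻¹' {b}) * Real.log (μ.real (φ ∘ f ⁻¹' {a}))) := by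
    rw [Finset.sum_neg_distrib, ← Finset.sum_mul, ← hsum, Real.negMulLog, neg_mul]
  rw [h1]
  refine Finset.sum_le_sum fun b hb => ?_
  rw [Real.negMulLog, neg_mul]
  rcases (measureReal_nonneg (μ := μ) (s := f ⁻¹' {b})).eq_or_lt with h0 | h0
  · simp [← h0]
  · have hle : μ.real (f ⁻¹' {b}) ≤ μ.real (φ ∘ f ⁻¹' {a}) := by
      rw [hsum]
      exact Finset.single_le_sum (f := fun b => μ.real (f ⁻¹' {b}))
        (fun _ _ => measureReal_nonneg) hb
    have := Real.log_le_log h0 hle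
    gcongr

theorem labelEntropy_le_of_factorsThrough {ι κ : Type} [Fintype κ] [Fintype ι] {f : Ω → κ}
    {g : Ω → ι} (hf : ∀ a, MeasurableSet (f ⁻¹' {a})) (h : g.FactorsThrough f) :
    labelEntropy μ g ≤ labelEntropy μ f := by
  have : Nonempty ι := (nonempty_of_isProbabilityMeasure μ).map g
  obtain ⟨φ, rfl⟩ := (Function.factorsThrough_iff g).1 h
  exact labelEntropy_comp_le μ hf φ

theorem measurableSet_prodMk_label {ι κ : Type} {f : Ω → ι} {g : Ω → κ}
    (hf : ∀ a, MeasurableSet (f ⁻¹' {a})) (hg : ∀ a, MeasurableSet (g ⁻¹' {a})) (c : ι × κ) :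
    MeasurableSet ((fun x => (f x, g x)) ⁻¹' {c}) := by
  have : (fun x => (f x, g x)) ⁻¹' {c} = f ⁻¹' {c.1} ∩ g ⁻¹' {c.2} := by
    ext x
    simp [Prod.ext_iff]
  rw [this]
  exact (hf _).inter (hg _)

/-- Gibbs' inequality for the joint distribution against the product of its marginals. -/
theorem labelEntropy_prodMk_le {ι κ : Type} [Fintype κ] [Fintype ι] {f : Ω → ι}
    {g : Ω → κ} (hf : ∀ a, MeasurableSet (f ⁻¹' {a})) (hg : ∀ a, MeasurableSet (g ⁻¹' {a})) :
    labelEntropy μ (fun x => (f x, g x)) ≤ labelEntropy μ f + labelEntropy μ g := by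
  classical
  have hfg := measurableSet_prodMk_label hf hg
  set p : ι × κ → ℝ := fun c => μ.real ((fun x => (f x, g x)) ⁻¹' {c}) with hp
  have hp0 : ∀ c, 0 ≤ p c := fun _ => measureReal_nonneg
  have h1 : ∀ a, μ.real (f ⁻¹' {a}) = ∑ b, p (a, b) := by
    intro a
    refine (measureReal_preimage_comp μ hfg Prod.fst a).trans ?_
    rw [Finset.sum_filter, Fintype.sum_prod_type, Finset.sum_eq_single a]
    · simp [hp]
    · intro b _ hb
      simp [hb]
    · simp
  have h2 : ∀ b, μ.real (g ⁻¹' {b}) = ∑ a, p (a, b) := by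
    intro b
    refine (measureReal_preimage_comp μ hfg Prod.snd b).trans ?_
    rw [Finset.sum_filter, Fintype.sum_prod_type_right, Finset.sum_eq_single b]
    · simp [hp]
    · intro b _ hb
      simp [hb]
    · simp
  have hle1 : ∀ a b, p (a, b) ≤ μ.real (f ⁻¹' {a}) := fun a b => by
    rw [h1]
    exact Finset.single_le_sum (f := fun b => p (a, b)) (fun _ _ => hp0 _) (Finset.mem_univ b)
  have hle2 : ∀ a b, p (a, b) ≤ μ.real (g ⁻¹' {b}) := fun a b => by
    rw [h2]
    exact Finset.single_le_sum (f := fun a => p (a, b)) (fun _ _ => hp0 _) (Finset.mem_univ a)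
  refine (sum_negMulLog_le (p := p)
    (q := fun c => μ.real (f ⁻¹' {c.1}) * μ.real (g ⁻¹' {c.2})) hp0
    (fun _ => mul_nonneg measureReal_nonneg measureReal_nonneg) ?_ ?_).trans ?_
  · rintro ⟨a, b⟩ h
    have h0 : 0 < p (a, b) := (hp0 _).lt_of_ne' h
    exact mul_ne_zero (h0.trans_le (hle1 a b)).ne' (h0.trans_le (hle2 a b)).ne'
  · rw [sum_measureReal_label μ hfg, Fintype.sum_prod_type]
    simp only [← Finset.mul_sum, sum_measureReal_label μ hg, mul_one, sum_measureReal_label μ hf,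
      le_refl]
  · have hsplit : ∀ c : ι × κ, -(p c * Real.log (μ.real (f ⁻¹' {c.1}) * μ.real (g ⁻¹' {c.2}))) =
        -(p c * Real.log (μ.real (f ⁻¹' {c.1}))) + -(p c * Real.log (μ.real (g ⁻¹' {c.2}))) := by
      rintro ⟨a, b⟩
      rcases (hp0 (a, b)).eq_or_lt with h0 | h0
      · simp [← h0]
      · rw [Real.log_mul (h0.trans_le (hle1 a b)).ne' (h0.trans_le (hle2 a b)).ne']
        ring
    rw [Finset.sum_congr rfl fun c _ => hsplit c, Finset.sum_add_distrib]
    refine le_of_eq (congrArg₂ (· + ·) ?_ ?_)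
    · rw [Fintype.sum_prod_type]
      refine Finset.sum_congr rfl fun a _ => ?_
      dsimp only
      rw [Finset.sum_neg_distrib, ← Finset.sum_mul, ← h1, Real.negMulLog, neg_mul]
    · rw [Fintype.sum_prod_type_right]
      refine Finset.sum_congr rfl fun b _ => ?_
      dsimp only
      rw [Finset.sum_neg_distrib, ← Finset.sum_mul, ← h2, Real.negMulLog, neg_mul]

theorem measurableSet_pi_label {n : ℕ} {κ : ℕ → Type} {e : ∀ i, Ω → κ i}
    (he : ∀ i a, MeasurableSet (e i ⁻¹' {a})) (a : ∀ i : Fin n, κ i) :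
    MeasurableSet ((fun x => fun i : Fin n => e i x) ⁻¹' {a}) := by
  have : (fun x => fun i : Fin n => e i x) ⁻¹' {a} = ⋂ i : Fin n, e i ⁻¹' {a i} := by
    ext x
    simp [funext_iff]
  rw [this]
  exact MeasurableSet.iInter fun i => he _ _

theorem labelEntropy_pi_le {κ : ℕ → Type} [∀ i, Fintype (κ i)] {e : ∀ i, Ω → κ i}
    (he : ∀ i a, MeasurableSet (e i ⁻¹' {a})) (n : ℕ) :
    labelEntropy μ (fun x => fun i : Fin n => e i x) ≤
      ∑ i ∈ Finset.range n, labelEntropy μ (e i) := by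
  induction n with
  | zero =>
    refine (labelEntropy_le_log_card μ (measurableSet_pi_label he)).trans ?_
    simp
  | succ n ih =>
    rw [Finset.sum_range_succ]
    refine le_trans ?_ ((labelEntropy_prodMk_le μ (measurableSet_pi_label he) (he n)).trans
      (add_le_add_left ih _))
    refine labelEntropy_le_of_factorsThrough μ
      (measurableSet_prodMk_label (measurableSet_pi_label he) (he n)) ?_
    intro x y h
    funext i
    refine Fin.lastCases ?_ (fun i => ?_) i
    · exact congrArg Prod.snd h
    · exact congrFun (congrArg Prod.fst h) i

/-- A function with a bounded number of values which is constant up to small probabilities has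
small entropy. -/
theorem exists_labelEntropy_option_le (K : ℕ) {η : ℝ} (hη : 0 < η) :
    ∃ ε > (0 : ℝ), ∀ {Ω : Type u} [MeasurableSpace Ω] (μ : Measure Ω) [IsProbabilityMeasure μ]
      (c : ℕ) (e : Ω → Option (Fin c)), c ≤ K → (∀ a, MeasurableSet (e ⁻¹' {a})) →
      (∀ i, μ.real (e ⁻¹' {some i}) ≤ ε) → labelEntropy μ e ≤ η := by
  have hη' : 0 < η / (K + 1) := by positivity
  have hc0 := (Real.continuous_negMulLog.tendsto 0).eventually
    (gt_mem_nhds (show Real.negMulLog 0 < η / (K + 1) by simpa using hη'))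
  have hc1 := (Real.continuous_negMulLog.tendsto 1).eventually
    (gt_mem_nhds (show Real.negMulLog 1 < η / (K + 1) by simpa using hη'))
  rw [Metric.eventually_nhds_iff] at hc0 hc1
  obtain ⟨t0, ht0, h0⟩ := hc0
  obtain ⟨t1, ht1, h1⟩ := hc1
  -- The first bound keeps each small mass strictly below t0. The second keeps the sum of at most K
  -- of them below t1, so the mass of `none` is within t1 of 1.
  refine ⟨min (t0 / 2) (t1 / (K + 1)), by positivity, ?_⟩
  intro Ω _ μ _ c e hc he hε
  have hcK : (c : ℝ) ≤ K := by exact_mod_cast hc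
  have hsum := sum_measureReal_label μ he
  rw [Fintype.sum_option] at hsum
  have hsmall : ∑ i, μ.real (e ⁻¹' {some i}) < t1 := by
    calc ∑ i, μ.real (e ⁻¹' {some i}) ≤ ∑ _i : Fin c, t1 / (K + 1) :=
          Finset.sum_le_sum fun i _ => (hε i).trans (min_le_right _ _)
      _ = c * (t1 / (K + 1)) := by simp
      _ ≤ K * (t1 / (K + 1)) := by gcongr
      _ < (K + 1) * (t1 / (K + 1)) := by gcongr; linarith
      _ = t1 := by field_simp
  have hnn : 0 ≤ ∑ i, μ.real (e ⁻¹' {some i}) :=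
    Finset.sum_nonneg fun i _ => measureReal_nonneg
  have hnone : Real.negMulLog (μ.real (e ⁻¹' {none})) ≤ η / (K + 1) := by
    refine (h1 ?_).le
    rw [Real.dist_eq, abs_lt]
    constructor <;> linarith
  have hsome : ∀ i, Real.negMulLog (μ.real (e ⁻¹' {some i})) ≤ η / (K + 1) := fun i => by
    refine (h0 ?_).le
    rw [Real.dist_eq, sub_zero, abs_of_nonneg measureReal_nonneg]
    have := (hε i).trans (min_le_left _ _)
    linarith
  rw [labelEntropy, shannonEntropy, Fintype.sum_option]
  calc _ ≤ η / (K + 1) + ∑ _i : Fin c, η / (K + 1) :=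
        add_le_add hnone (Finset.sum_le_sum fun i _ => hsome i)
    _ = (1 + c) * (η / (K + 1)) := by simp; ring
    _ ≤ (1 + K) * (η / (K + 1)) := by gcongr
    _ = η := by field_simp; ring

end

namespace PartitionSeq

universe u

variable {X : ℕ → Type u} [∀ n, MeasurableSpace (X n)] (P : PartitionSeq X)

theorem exists_mem_cell (n : ℕ) (x : X n) : ∃ i, x ∈ P.cell n i := by
  have : x ∈ ⋃ i, P.cell n i := P.iUnion_cell n ▸ Set.mem_univ x
  simpa using this

/-- The index of the cell containing a point. -/
noncomputable def label (n : ℕ) (x : X n) : Fin (P.card n) := (P.exists_mem_cell n x).choose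

theorem label_eq_iff {n : ℕ} {x : X n} {i : Fin (P.card n)} :
    P.label n x = i ↔ x ∈ P.cell n i := by
  have h := (P.exists_mem_cell n x).choose_spec
  refine ⟨fun e => e ▸ h, fun hi => ?_⟩
  by_contra hne
  exact Set.disjoint_left.1 (P.disjoint_cell n _ _ hne) h hi

theorem label_preimage (n : ℕ) (i : Fin (P.card n)) : P.label n ⁻¹' {i} = P.cell n i :=
  Set.ext fun _ => P.label_eq_iff

theorem shannonEntropy_joinCell (f : ∀ n, X n → X (n + 1)) (μ : Measure (X 0)) (n : ℕ) :
    shannonEntropy μ (P.joinCell f n) =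
      labelEntropy μ fun x => fun i : Fin n => P.label i (iter f i x) := by
  refine congrArg (fun A => shannonEntropy μ A) (funext fun a => ?_)
  ext x
  simp only [joinCell, Set.mem_iInter, Set.mem_preimage, Set.mem_singleton_iff, funext_iff,
    label_eq_iff]

end PartitionSeq

end NDS

/-! ### Cylinders generate the Borel structure. -/

namespace NSFT

open Filter NDS MeasureTheory

variable {S : NSFT}

theorem isOpen_cylinder {k m : ℕ} (h : k ≤ m) (x : ∀ i, Fin (S.l i)) :
    IsOpen (cylinder k m x) :=
  isOpen_of_word h fun _ _ hyz hy i hi him =>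
    (Seq.word_eq_iff.1 hyz i hi him).symm.trans (hy i hi him)

theorem isTopologicalBasis_cylinder (k : ℕ) :
    TopologicalSpace.IsTopologicalBasis {A : Set (S.Seq k) | ∃ m ≥ k, ∃ x, cylinder k m x = A} := by
  refine TopologicalSpace.isTopologicalBasis_of_isOpen_of_nhds ?_ ?_
  · rintro _ ⟨m, hm, x, rfl⟩
    exact isOpen_cylinder hm x
  · intro a u ha hu
    obtain ⟨δ, hδ, hball⟩ := Metric.isOpen_iff.1 hu a ha
    obtain ⟨C, hC⟩ := S.exists_uniform_small_cylinders hδ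
    obtain ⟨r, hr, -, h⟩ := hC k
    refine ⟨_, ⟨r, hr, a.full, rfl⟩, fun i hi _ => (a.full_of_le hi).symm, fun y hy => ?_⟩
    apply hball
    rw [Metric.mem_ball]
    exact h y a (Seq.word_eq_iff.2 fun i hi hir => (hy i hi hir).trans (a.full_of_le hi))

theorem measurableSpace_eq_generateFrom (k : ℕ) :
    (inferInstance : MeasurableSpace (S.Seq k)) =
      MeasurableSpace.generateFrom {A | ∃ m ≥ k, ∃ x, cylinder k m x = A} :=
  (isTopologicalBasis_cylinder k).borel_eq_generateFrom

/-- Two cylinders that meet are nested; any common point describes the intersection. -/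
theorem isPiSystem_cylinder (k : ℕ) :
    IsPiSystem {A : Set (S.Seq k) | ∃ m ≥ k, ∃ x, cylinder k m x = A} := by
  rintro _ ⟨m, hm, x, rfl⟩ _ ⟨m', hm', x', rfl⟩ ⟨y, hy, hy'⟩
  refine ⟨max m m', le_max_of_le_left hm, y.full, ?_⟩
  ext z
  constructor
  · intro hz
    refine ⟨fun i hi him => ?_, fun i hi him => ?_⟩
    · rw [hz i hi (him.trans (le_max_left _ _)), y.full_of_le hi, hy i hi him]
    · rw [hz i hi (him.trans (le_max_right _ _)), y.full_of_le hi, hy' i hi him]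
  · rintro ⟨hz, hz'⟩ i hi him
    rw [y.full_of_le hi]
    rcases le_max_iff.1 him with h | h
    · rw [hz i hi h, hy i hi h]
    · rw [hz' i hi h, hy' i hi h]

theorem shift_preimage_cylinder {k m : ℕ} (h : k + 1 ≤ m) (x : ∀ i, Fin (S.l i)) :
    S.shift k ⁻¹' cylinder (k + 1) m x = ⋃ α, cylinder k m (Function.update x k α) := by
  ext y
  simp only [Set.mem_iUnion]
  constructor
  · intro hy
    have hk : ∀ β, Function.update x k β k = β := fun β => Function.update_self ..
    refine ⟨y.letter k le_rfl, fun i hi him => ?_⟩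
    by_cases hik : i = k
    · subst hik
      exact (hk _).symm
    · rw [Function.update_of_ne hik]
      exact hy i (by omega) him
  · rintro ⟨α, hα⟩ i hi him
    have := hα i (by omega) him
    have hik : i ≠ k := by omega
    rw [Function.update_of_ne hik] at this
    exact this

theorem measurable_shift (k : ℕ) : Measurable (S.shift k) := by
  refine Continuous.measurable ((isTopologicalBasis_cylinder (k + 1)).continuous_iff.2 ?_)
  rintro _ ⟨m, hm, x, rfl⟩
  rw [shift_preimage_cylinder hm]
  exact isOpen_iUnion fun α => isOpen_cylinder (by omega) _

/-! ### Parry measures and bounds for the metric entropy. -/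

section Parry

variable {w' v' : ∀ i, Fin (S.l i) → ℝ}

theorem dotProduct_pos (hw : S.IsColSeq w') (hv : S.IsRowSeq v') (k : ℕ) : 0 < v' k ⬝ᵥ w' k := by
  have : Nonempty (Fin (S.l k)) := ⟨⟨0, S.l_pos k⟩⟩
  exact Finset.sum_pos (fun α _ => mul_pos ((hv k).1 α) ((hw k).1 α)) Finset.univ_nonempty

/-- Both sides are v̂_k L_k ŵ_{k+1}; a single normalizing constant thus serves all times. -/
theorem dotProduct_succ (hw : S.IsColSeq w') (hv : S.IsRowSeq v') (k : ℕ) :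
    v' (k + 1) ⬝ᵥ w' (k + 1) = v' k ⬝ᵥ w' k := by
  conv_rhs => rw [(hw k).2]
  rw [← (hv k).2, Matrix.dotProduct_mulVec]

theorem parryVec_eq (hw : S.IsColSeq w') (k : ℕ) (α : Fin (S.l k)) :
    parryVec w' v' k α = v' k α * w' k α / (v' k ⬝ᵥ w' k) := by
  have h := (vecNorm_pos hw k).ne'
  simp only [parryVec, rowVec, colVec, dotProduct_smul, Pi.smul_apply, smul_eq_mul, mul_inv,
    inv_inv]
  field_simp

theorem parryMat_eq (hw : S.IsColSeq w') (i : ℕ) (α : Fin (S.l i)) (β : Fin (S.l (i + 1))) :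
    S.parryMat w' i α β = S.L i α β * w' (i + 1) β / w' i α := by
  have h := (vecNorm_pos hw i).ne'
  have h' := (vecNorm_pos hw (i + 1)).ne'
  have h'' := ((hw i).1 α).ne'
  simp only [parryMat, eigen, colVec, Matrix.smul_apply, Matrix.mul_diagonal,
    Matrix.diagonal_mul, Pi.smul_apply, smul_eq_mul]
  field_simp

theorem parryVec_nonneg (hw : S.IsColSeq w') (hv : S.IsRowSeq v') (k : ℕ) (α : Fin (S.l k)) :
    0 ≤ parryVec w' v' k α := by
  rw [parryVec_eq hw]
  exact div_nonneg (mul_nonneg ((hv k).1 α).le ((hw k).1 α).le) (dotProduct_pos hw hv k).le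

theorem parryMat_nonneg (hw : S.IsColSeq w') (i : ℕ) (α : Fin (S.l i)) (β : Fin (S.l (i + 1))) :
    0 ≤ S.parryMat w' i α β := by
  rw [parryMat_eq hw]
  exact div_nonneg (mul_nonneg (L_nonneg _ _ _) ((hw _).1 β).le) ((hw i).1 α).le

theorem sum_parryVec_mul_parryMat (hw : S.IsColSeq w') (hv : S.IsRowSeq v') (k : ℕ)
    (β : Fin (S.l (k + 1))) :
    ∑ α, parryVec w' v' k α * S.parryMat w' k α β = parryVec w' v' (k + 1) β := by
  rw [parryVec_eq hw, dotProduct_succ hw hv]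
  have h1 : v' (k + 1) β = ∑ α, v' k α * S.L k α β := by rw [← (hv k).2]; rfl
  rw [h1, Finset.sum_mul, Finset.sum_div]
  refine Finset.sum_congr rfl fun α _ => ?_
  have h2 := ((hw k).1 α).ne'
  rw [parryVec_eq hw, parryMat_eq hw]
  field_simp

/-- The quotients ŵ_{i+1}/ŵ_i telescope. Equality holds for admissible words, and otherwise the
product vanishes. -/
theorem parry_cylinder_le (hw : S.IsColSeq w') (hv : S.IsRowSeq v') {k m : ℕ} (h : k ≤ m)
    (x : ∀ i, Fin (S.l i)) :
    parryVec w' v' k (x k) * ∏ i ∈ Finset.Ico k m, S.parryMat w' i (x i) (x (i + 1)) ≤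
      v' k (x k) * w' m (x m) / (v' k ⬝ᵥ w' k) := by
  induction m, h using Nat.le_induction with
  | base => simp [parryVec_eq hw]
  | succ m hm ih =>
    rw [Finset.prod_Ico_succ_top hm, ← mul_assoc]
    refine (mul_le_mul_of_nonneg_right ih (parryMat_nonneg hw _ _ _)).trans ?_
    have h0 := (hw m).1 (x m)
    have h1 := (hw (m + 1)).1 (x (m + 1))
    have h2 := (hv k).1 (x k)
    have hc := dotProduct_pos hw hv k
    have hL : S.L m (x m) (x (m + 1)) ≤ 1 := by
      rcases S.entries m (x m) (x (m + 1)) with h | h <;> simp [h]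
    rw [parryMat_eq hw]
    calc _ = S.L m (x m) (x (m + 1)) * (v' k (x k) * w' (m + 1) (x (m + 1)) / (v' k ⬝ᵥ w' k)) := by
          field_simp
      _ ≤ _ := mul_le_of_le_one_left (by positivity) hL

variable {μ : ∀ k, Measure (S.Seq k)}

/-- Invariance is deduced from the cylinder values: summing over the forgotten letter gives π_k P_k
= π_{k+1}, and cylinders form a generating π-system. Inadmissible letters contribute empty cylinders
of weight 0. -/
theorem IsParryIMS.measurePreserving_shift (hμ : S.IsParryIMS w' v' μ) (k : ℕ) :
    MeasurePreserving (S.shift k) (μ k) (μ (k + 1)) := by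
  refine ⟨measurable_shift k, ?_⟩
  have := hμ.isProb
  have : IsProbabilityMeasure ((μ k).map (S.shift k)) :=
    Measure.isProbabilityMeasure_map (measurable_shift k).aemeasurable
  refine ext_of_generate_finite _ (measurableSpace_eq_generateFrom (k + 1))
    (isPiSystem_cylinder (k + 1)) ?_ (by simp)
  rintro _ ⟨m, hm, x, rfl⟩
  have hw := hμ.colSeq
  have hv := hμ.rowSeq
  rw [Measure.map_apply (measurable_shift k) (isOpen_cylinder hm x).measurableSet,
    shift_preimage_cylinder hm, measure_iUnion, tsum_fintype, hμ.cylinder_eq _ _ hm]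
  · have hterm : ∀ α, μ k (cylinder k m (Function.update x k α)) = ENNReal.ofReal
        (parryVec w' v' k α * S.parryMat w' k α (x (k + 1)) *
          ∏ i ∈ Finset.Ico (k + 1) m, S.parryMat w' i (x i) (x (i + 1))) := by
      intro α
      have hne : k + 1 ≠ k := by omega
      rw [hμ.cylinder_eq k m (by omega), Finset.prod_eq_prod_Ico_succ_bot (by omega),
        Function.update_self, Function.update_of_ne hne, mul_assoc]
      congr 3
      refine Finset.prod_congr rfl fun i hi => ?_
      have hi' := Finset.mem_Ico.1 hi
      have h1 : i ≠ k := by omega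
      have h2 : i + 1 ≠ k := by omega
      rw [Function.update_of_ne h1, Function.update_of_ne h2]
    rw [Finset.sum_congr rfl fun α _ => hterm α, ← ENNReal.ofReal_sum_of_nonneg, ← Finset.sum_mul,
      sum_parryVec_mul_parryMat hw hv]
    intro α _
    exact mul_nonneg (mul_nonneg (parryVec_nonneg hw hv _ _) (parryMat_nonneg hw _ _ _))
      (Finset.prod_nonneg fun i _ => parryMat_nonneg hw _ _ _)
  · intro α β hαβ
    refine Set.disjoint_left.2 fun y hy hy' => hαβ ?_
    have h1 := hy k le_rfl (by omega)
    have h2 := hy' k le_rfl (by omega)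
    rw [Function.update_self] at h1 h2
    exact h1.symm.trans h2
  · exact fun α => (isOpen_cylinder (by omega) _).measurableSet

theorem IsParryIMS.measurePreserving_iter (hμ : S.IsParryIMS w' v' μ) (n : ℕ) :
    MeasurePreserving (iter S.shift n) (μ 0) (μ n) := by
  induction n with
  | zero => exact MeasurePreserving.id _
  | succ n ih => exact (hμ.measurePreserving_shift n).comp ih

theorem measurableSet_of_word {k r : ℕ} (hr : k ≤ r) {A : Set (S.Seq k)}
    (h : ∀ x y, x.word r = y.word r → x ∈ A → y ∈ A) : MeasurableSet A :=
  (isOpen_of_word hr h).measurableSet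

/-- The partitions into the cylinders of length one. -/
def letterPartition (S : NSFT) : PartitionSeq S.Seq where
  card := S.l
  cell n α := {x | x.letter n le_rfl = α}
  measurable_cell n α := (isOpen_letter_eq n α).measurableSet
  disjoint_cell _ _ _ h := Set.disjoint_left.2 fun _ hx hy => h (hx.symm.trans hy)
  iUnion_cell n := Set.eq_univ_of_forall fun x => Set.mem_iUnion.2 ⟨x.letter n le_rfl, rfl⟩

/-- The cells are clopen, hence compact, and lie at mutual distance 1, so they serve as their own
compact cores for every ε. -/
theorem isAdmissible_letterPartition (μ : ∀ k, Measure (S.Seq k)) :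
    S.letterPartition.IsAdmissible μ := by
  refine ⟨S.l_bdd, fun ε hε => ⟨1, one_pos, S.letterPartition.cell, fun n =>
    ⟨fun i => ⟨?_, subset_rfl⟩, fun i => by simp, fun i j hij x hx y hy => ?_⟩⟩⟩
  · refine IsClosed.isCompact (isOpen_compl_iff.1 (isOpen_of_word le_rfl ?_))
    intro x y h hx hy
    exact hx ((Seq.word_eq_iff.1 h n le_rfl le_rfl).trans hy)
  · by_contra h
    have := agree_of_dist_lt_one (not_le.1 h)
    exact hij.ne (hx.symm.trans (this.trans hy))

theorem letterPartition_label (n : ℕ) (x : S.Seq n) :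
    S.letterPartition.label n x = x.letter n le_rfl :=
  S.letterPartition.label_eq_iff.2 rfl

theorem IsParryIMS.measureReal_itinerary_le (hμ : S.IsParryIMS w' v' μ) (m : ℕ)
    (a : ∀ i : Fin (m + 1), Fin (S.l i)) :
    (μ 0).real ((fun x => fun i : Fin (m + 1) =>
      S.letterPartition.label i (iter S.shift i x)) ⁻¹' {a}) ≤
      vecNorm (v' 0) / (v' 0 ⬝ᵥ w' 0) * vecNorm (w' m) := by
  let z : ∀ i, Fin (S.l i) := fun i => if h : i < m + 1 then a ⟨i, h⟩ else ⟨0, S.l_pos i⟩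
  have hz : ∀ i (hi : i < m + 1), z i = a ⟨i, hi⟩ := fun i hi => dif_pos hi
  have hset : (fun x => fun i : Fin (m + 1) =>
      S.letterPartition.label i (iter S.shift i x)) ⁻¹' {a} = cylinder 0 m z := by
    ext x
    constructor
    · intro h i hi him
      have h1 := (letterPartition_label i _).symm.trans (congrFun h ⟨i, by omega⟩)
      rw [iter_letter] at h1
      exact h1.trans (hz i (by omega)).symm
    · intro h
      refine funext fun ⟨i, hi⟩ => (letterPartition_label i _).trans ?_
      rw [iter_letter, h i _ (by omega)]
      exact hz i hi
  have hw := hμ.colSeq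
  have hv := hμ.rowSeq
  have hc := dotProduct_pos hw hv 0
  rw [hset, Measure.real, hμ.cylinder_eq 0 m (Nat.zero_le m), ENNReal.toReal_ofReal]
  · refine (parry_cylinder_le hw hv (Nat.zero_le m) z).trans ?_
    rw [div_mul_eq_mul_div]
    have h1 := le_vecNorm (v' 0) (z 0)
    have h2 := le_vecNorm (w' m) (z m)
    have h3 := (hw m).1 (z m)
    have h4 := (hv 0).1 (z 0)
    have h5 := h4.le.trans h1
    gcongr
  · exact mul_nonneg (parryVec_nonneg hw hv _ _)
      (Finset.prod_nonneg fun i _ => parryMat_nonneg hw _ _ _)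

theorem IsParryIMS.eigenGrowth_le_metricEntropy (hμ : S.IsParryIMS w' v' μ) :
    S.eigenGrowth w' ≤ metricEntropy S.shift μ := by
  refine le_trans ?_ (le_iSup₂_of_le S.letterPartition (isAdmissible_letterPartition μ) le_rfl)
  have hw := hμ.colSeq
  have hv := hμ.rowSeq
  have := hμ.isProb
  obtain ⟨B, hB⟩ := S.l_bdd
  have hB1 : 0 < B := (S.l_pos 0).trans_le (hB 0)
  set D := vecNorm (v' 0) / (v' 0 ⬝ᵥ w' 0)
  have hD : 0 < D := div_pos
    (((hv 0).1 ⟨0, S.l_pos 0⟩).trans_le (le_vecNorm _ _)) (dotProduct_pos hw hv 0)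
  -- The constant collects log ‖ŵ_0‖ from λ^{(0,m+1)}, D from the cylinder bound, and B² from
  -- w(m,m+1), which pays for replacing ‖ŵ_m‖ by ‖ŵ_{m+1}‖.
  refine limsup_div_le_limsup_div fun η hη =>
    ⟨Real.log (vecNorm (w' 0)) + Real.log D + Real.log ((B : ℝ) ^ 2), ?_⟩
  filter_upwards [eventually_gt_atTop 0] with n hn
  obtain ⟨m, rfl⟩ : ∃ m, n = m + 1 := ⟨n - 1, by omega⟩
  have h0 := vecNorm_pos hw 0
  have hm := vecNorm_pos hw m
  have hm1 := vecNorm_pos hw (m + 1)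
  have hH : -Real.log (D * vecNorm (w' m)) ≤
      shannonEntropy (μ 0) (S.letterPartition.joinCell S.shift (m + 1)) := by
    rw [PartitionSeq.shannonEntropy_joinCell]
    refine neg_log_le_labelEntropy _ (measurableSet_pi_label
      (e := fun i x => S.letterPartition.label i (iter S.shift i x)) fun i a => ?_)
      (hμ.measureReal_itinerary_le m)
    have := (hμ.measurePreserving_iter i).measurable (S.letterPartition.measurable_cell i a)
    rwa [← PartitionSeq.label_preimage] at this
  rw [Real.log_mul hD.ne' hm.ne'] at hH
  have hstep : vecNorm (w' m) ≤ (B : ℝ) ^ 2 * vecNorm (w' (m + 1)) := by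
    refine (vecNorm_le_mul hw (Nat.le_succ m)).trans ?_
    have : (S.w m (m + 1) : ℝ) ≤ (B : ℝ) ^ 2 := by exact_mod_cast w_le_pow hB m 1
    gcongr
  have hlog := Real.log_le_log hm hstep
  rw [Real.log_mul (by positivity) hm1.ne'] at hlog
  rw [eigenProd_eq hw (Nat.zero_le _), Real.log_div h0.ne' hm1.ne']
  have : 0 ≤ η * (m + 1 : ℕ) := by positivity
  linarith

/-- A cylinder of diameter below δ meets at most one compact core, so it predicts the cell except on
a set of small measure. A long word together with the corrections at each time determines the
itinerary; the word costs log w(0,n) + log C, each correction at most η. -/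
theorem IsParryIMS.shannonEntropy_joinCell_le (hμ : S.IsParryIMS w' v' μ) {P : PartitionSeq S.Seq}
    (hP : P.IsAdmissible μ) {η : ℝ} (hη : 0 < η) :
    ∃ C : ℝ, ∀ n : ℕ,
      shannonEntropy (μ 0) (P.joinCell S.shift n) ≤ Real.log (S.w 0 n) + C + η * n := by
  classical
  have := hμ.isProb
  obtain ⟨⟨N, hN⟩, hadm⟩ := hP
  obtain ⟨ε, hε, hent⟩ := exists_labelEntropy_option_le.{0} N hη
  obtain ⟨δ, hδ, K, hK⟩ := hadm ε hε
  obtain ⟨C, hC⟩ := S.exists_uniform_small_cylinders hδ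
  choose r hr hrC hrδ using hC
  -- The predicted cell: the one whose core meets the cylinder of y, if any.
  let q : ∀ n, S.Seq n → Option (Fin (P.card n)) := fun n y =>
    if h : ∃ i, ∃ z ∈ K n i, z.word (r n) = y.word (r n) then some h.choose else none
  have hq : ∀ n (x y : S.Seq n), x.word (r n) = y.word (r n) → q n x = q n y := by
    intro n x y h
    simp only [q, h]
  have hqK : ∀ n i, ∀ y ∈ K n i, q n y = some i := by
    intro n i y hy
    have hex : ∃ i, ∃ z ∈ K n i, z.word (r n) = y.word (r n) := ⟨i, y, hy, rfl⟩
    have hval : q n y = some hex.choose := dif_pos hex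
    obtain ⟨z, hz, hzy⟩ := hex.choose_spec
    have hlt := hrδ n z y hzy
    rw [hval]
    congr 1
    rcases lt_trichotomy hex.choose i with h | h | h
    · exact absurd ((hK n).2.2 _ _ h z hz y hy) (not_le.2 hlt)
    · exact h
    · exact absurd ((hK n).2.2 _ _ h y hy z hz) (not_le.2 (dist_comm z y ▸ hlt))
  -- The correction: `none` when the prediction is right, the true cell otherwise.
  let e : ∀ n, S.Seq n → Option (Fin (P.card n)) := fun n y =>
    if q n y = some (P.label n y) then none else some (P.label n y)
  have he_some : ∀ n i, e n ⁻¹' {some i} = P.cell n i \ q n ⁻¹' {some i} := by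
    intro n i
    ext y
    simp only [e, Set.mem_preimage, Set.mem_singleton_iff, Set.mem_sdiff, ← P.label_eq_iff]
    split_ifs with h
    · simp only [false_iff, not_and, not_not]
      rintro rfl
      exact h
    · simp only [Option.some.injEq]
      refine ⟨fun hi => ⟨hi, hi ▸ h⟩, fun hi => hi.1⟩
  have he_meas_some : ∀ n i, MeasurableSet (e n ⁻¹' {some i}) := by
    intro n i
    rw [he_some]
    refine (P.measurable_cell n i).diff (measurableSet_of_word (hr n) fun x y h hx => ?_)
    exact (hq n x y h).symm.trans hx
  have he_meas : ∀ n a, MeasurableSet (e n ⁻¹' {a}) := by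
    intro n a
    cases a with
    | some i => exact he_meas_some n i
    | none =>
      have : e n ⁻¹' {none} = (⋃ i, e n ⁻¹' {some i})ᶜ := by
        ext y
        simp [Option.eq_none_iff_forall_ne_some]
      rw [this]
      exact (MeasurableSet.iUnion fun i => he_meas_some n i).compl
  have he_small : ∀ n i, (μ n).real (e n ⁻¹' {some i}) ≤ ε := by
    intro n i
    have hsub : e n ⁻¹' {some i} ⊆ P.cell n i \ K n i := by
      rw [he_some]
      exact Set.sdiff_subset_sdiff_right fun y hy => hqK n i y hy
    exact ENNReal.toReal_le_of_le_ofReal hε.le ((measure_mono hsub).trans ((hK n).2.1 i))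
  have hiter := hμ.measurePreserving_iter
  have hE_meas : ∀ i a, MeasurableSet ((fun x => e i (iter S.shift i x)) ⁻¹' {a}) := fun i a =>
    (hiter i).measurable (he_meas i a)
  have hE : ∀ i, labelEntropy (μ 0) (fun x => e i (iter S.shift i x)) ≤ η := by
    intro i
    refine hent (μ 0) _ _ (hN i) (hE_meas i) fun j => ?_
    have := (hiter i).measureReal_preimage (he_meas i (some j)).nullMeasurableSet
    exact this.trans_le (he_small i j)
  refine ⟨Real.log C, fun n => ?_⟩
  obtain ⟨R, hR, hRC⟩ := exists_common_end hr hrC n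
  have hword : ∀ z : S.Word 0 R, MeasurableSet ((fun x : S.Seq 0 => x.word R) ⁻¹' {z}) :=
    fun z => measurableSet_of_word (Nat.zero_le R) fun x y h hx => h.symm.trans hx
  have hpi := measurableSet_pi_label hE_meas (n := n)
  have hcard : Fintype.card (S.Word 0 R) = S.w 0 R := (Nat.card_eq_fintype_card).symm
  rw [PartitionSeq.shannonEntropy_joinCell]
  calc _ ≤ labelEntropy (μ 0)
        (fun x => (x.word R, fun i : Fin n => e i (iter S.shift i x))) := by
        refine labelEntropy_le_of_factorsThrough _ (measurableSet_prodMk_label hword hpi) ?_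
        intro x y h
        funext i
        have h1 : x.word R = y.word R := congrArg Prod.fst h
        have h2 : e i (iter S.shift i x) = e i (iter S.shift i y) :=
          congrFun (congrArg Prod.snd h) i
        -- Equal long words give equal predictions at every time i < n, so equal corrections yield
        -- equal cells.
        have h3 := hq i _ _ (Seq.word_eq_of_le (hR i i.2) (iter_word_eq (n := i) h1))
        simp only [e, h3] at h2
        split_ifs at h2 with h4 h5 h5
        · exact Option.some.inj (h4.symm.trans h5)
        · exact Option.some.inj h2
    _ ≤ labelEntropy (μ 0) (fun x : S.Seq 0 => x.word R) +
        labelEntropy (μ 0) (fun x => fun i : Fin n => e i (iter S.shift i x)) :=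
        labelEntropy_prodMk_le _ hword hpi
    _ ≤ Real.log (S.w 0 R) + ∑ _i ∈ Finset.range n, η := by
        refine add_le_add ?_ ((labelEntropy_pi_le _ hE_meas n).trans
          (Finset.sum_le_sum fun i _ => hE i))
        rw [← hcard]
        exact labelEntropy_le_log_card _ hword
    _ ≤ _ := by
        rw [Finset.sum_const, Finset.card_range, nsmul_eq_mul, mul_comm η]
        linarith [log_w_le hRC]

theorem IsParryIMS.metricEntropy_le_matGrowth (hμ : S.IsParryIMS w' v' μ) :
    metricEntropy S.shift μ ≤ S.matGrowth := by
  refine iSup₂_le fun P hP => ?_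
  rw [matGrowth_eq]
  refine limsup_div_le_limsup_div fun η hη => ?_
  obtain ⟨C, hC⟩ := hμ.shannonEntropy_joinCell_le hP hη
  exact ⟨C, Eventually.of_forall hC⟩

end Parry

end NSFT

theorem theorem4p10 (S : NSFT) (hprim : S.IsPrimitive)
    (w' v' : ∀ i, Fin (S.l i) → ℝ) (μ : ∀ k, MeasureTheory.Measure (S.Seq k))
    (hμ : S.IsParryIMS w' v' μ) :
    (S.eigenGrowth w' ≤ NDS.metricEntropy S.shift μ ∧
      NDS.metricEntropy S.shift μ ≤ S.matGrowth) ∧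
    (S.BestReceiversBroadcast →
      S.eigenGrowth w' = NDS.metricEntropy S.shift μ ∧
      NDS.metricEntropy S.shift μ = S.matGrowth ∧
      NDS.metricEntropy S.shift μ = NDS.topEntropy S.shift) ∧
    (S.eigenPrimGrowth w' = 0 →
      S.eigenGrowth w' = NDS.metricEntropy S.shift μ ∧
      NDS.metricEntropy S.shift μ = S.matGrowth ∧
      NDS.metricEntropy S.shift μ = NDS.topEntropy S.shift) ∧
    (S.IsUniformlyPrimitive → S.eigenPrimGrowth w' = 0) := by
  have h1 := hμ.eigenGrowth_le_metricEntropy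
  have h2 := hμ.metricEntropy_le_matGrowth
  -- This one inequality closes the chain of (i) and forces all equalities.
  have key : S.matGrowth ≤ S.eigenGrowth w' →
      S.eigenGrowth w' = NDS.metricEntropy S.shift μ ∧
      NDS.metricEntropy S.shift μ = S.matGrowth ∧
      NDS.metricEntropy S.shift μ = NDS.topEntropy S.shift := by
    intro h
    have h3 : NDS.metricEntropy S.shift μ = S.matGrowth := le_antisymm h2 (h.trans h1)
    exact ⟨le_antisymm h1 (h2.trans h), h3, h3.trans S.topEntropy_eq_matGrowth.symm⟩
  exact ⟨⟨h1, h2⟩,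
    fun h => key (NSFT.matGrowth_le_of_bestReceiversBroadcast hprim hμ.colSeq h),
    fun h => key (NSFT.matGrowth_le_of_eigenPrimGrowth hprim hμ.colSeq h),
    NSFT.eigenPrimGrowth_eq_zero hμ.colSeq⟩
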